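/- Let $d\ge 1$, and write $\widehat g(\xi)=\int_{\mathbb R^d} g(x)e^{-i\langle x,\xi\rangle}\,dx$. For $r>0$ let $\mathcal E_o(r)$ be the class of functions on $\mathbb R^d$ whose Fourier transform is supported in $\{\xi: r/2\le|\xi|\le r\}$, and for $\sigma\ge 0$ let $$\mathfrak M_{\sigma,r}g(x)=\sup_{y\in\mathbb R^d}\frac{|g(x+y)|}{(1+r|y|)^\sigma}.$$ For $M>0$ call a Schwartz function $\eta$ on $\mathbb R^d$ $M$-admissible if $\eta\in\mathcal E_o(1)$ and $\eta(x)\ge 1$ whenever $|x_i|\le 2^{-M}$ for $i=1,\dots,d$; put $\eta_k=2^{kd}\eta(2^k\cdot)$. For integers $k\ge N\ge 0$ and $j\in\{0,1,\dots,2^{k-N}-1\}^d$ let $$Q_{k,j}=\prod_{i=1}^d\big[j_i2^{-k+N},\,j_i2^{-k+N}+2^{-k-M}\big],\qquad h_k=\sum_{j\in\{0,\dots,2^{k-N}-1\}^d}\chi_{Q_{k,j}},\qquad f_k=h_k*\eta_k .$$ Then $M$-admissible functions $\eta$ exist for all sufficiently large $M$, and for every $M>0$ and every $M$-admissible $\eta$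 one has, for $k\ge N$, that $f_k$ is continuous and integrable with $f_k\in\mathcal E_o(2^k)$. Moreover, for $0<q\le p<\infty$ the following hold, with (quasi-)norms $\|\cdot\|_p$ taken over $\mathbb R^d$. (i) For every $\eta$ there is a constant $C=C(p,q,d,\eta)$ such that for all $M>0$ for which $\eta$ is $M$-admissible and all integers $N\ge0$ $$\Big\|\Big(\sum_{k=N}^{2^{Nd}}|f_k|^q\Big)^{1/q}\Big\|_p\le C .$$ (ii) For every $M>0$ there is a constant $c=c(p,q,d,M)>0$ such that for every $M$-admissible $\eta$ there is $N_0$ such that for all integers $N\ge N_0$ and all $0\le\sigma\le d/q$ $$\Big\|\Big(\sum_{k=N}^{2^{Nd}}|\mathfrak M_{\sigma,2^k}f_k|^q\Big)^{1/q}\Big\|_p\ge c\,\max\big\{2^{N(\frac dq-\sigma)},\,N^{1/q}\big\}.$$ -/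

import Mathlib

open MeasureTheory
open scoped ENNReal FourierTransform SchwartzMap

noncomputable section

namespace DyadicPeetre

/-- Euclidean space `ℝ^d`. -/
abbrev E (d : ℕ) : Type := EuclideanSpace ℝ (Fin d)

/-- `g` is a continuous integrable function whose Fourier transform
`∫ g(x) exp(-i⟨x,ξ⟩) dx` is supported in the annulus `r/2 ≤ |ξ| ≤ r`.
Mathlib's transform has the kernel `exp(-2πi⟨x,ξ⟩)`, so that its variable `ξ` corresponds to the
angular frequency `2πξ`. -/
def SpectrumInAnnulus {d : ℕ} (r : ℝ) (g : E d → ℂ) : Prop :=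
  Continuous g ∧ Integrable g ∧
    ∀ ξ : E d, 𝓕 g ξ ≠ 0 → r / 2 ≤ 2 * Real.pi * ‖ξ‖ ∧ 2 * Real.pi * ‖ξ‖ ≤ r

/-- The Schwartz functions of the construction: the Fourier transform is supported in
`1/2 ≤ |ξ| ≤ 1`, and `η(x) ≥ 1` (in particular `η(x)` is real) if `|x_i| ≤ 2^{-M}` for all `i`. -/
def IsAdmissible {d : ℕ} (M : ℝ) (η : 𝓢(E d, ℂ)) : Prop :=
  SpectrumInAnnulus 1 (fun x => η x) ∧
    ∀ x : E d, (∀ i, |x i| ≤ (2 : ℝ) ^ (-M)) → 1 ≤ (η x).re ∧ (η x).im = 0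

/-- The `L¹`-normalized dilate `η_k(x) = 2^{kd} η(2^k x)`. -/
def dilate {d : ℕ} (η : 𝓢(E d, ℂ)) (k : ℕ) (x : E d) : ℂ :=
  (2 : ℂ) ^ (k * d) * η ((2 : ℝ) ^ k • x)

/-- The cube `Q_{k,j} = ∏_i [j_i 2^{-k+N}, j_i 2^{-k+N} + 2^{-k-M}]`. -/
def cube {d : ℕ} (M : ℝ) (N k : ℕ) (j : Fin d → ℕ) : Set (E d) :=
  {x | ∀ i, (j i : ℝ) * (2 : ℝ) ^ (-(k : ℤ) + (N : ℤ)) ≤ x i ∧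
    x i ≤ (j i : ℝ) * (2 : ℝ) ^ (-(k : ℤ) + (N : ℤ)) + (2 : ℝ) ^ (-(k : ℝ) - M)}

/-- `h_k`, the sum of the characteristic functions of the cubes `Q_{k,j}` over
`j ∈ {0, 1, …, 2^{k-N} - 1}^d`; it is used for `k ≥ N` only. -/
def h {d : ℕ} (M : ℝ) (N k : ℕ) (x : E d) : ℂ :=
  ∑ j ∈ Fintype.piFinset (fun _ : Fin d => Finset.range (2 ^ (k - N))),
    (cube M N k j).indicator (fun _ => (1 : ℂ)) x

/-- `f_k = h_k * η_k`. -/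
def f {d : ℕ} (η : 𝓢(E d, ℂ)) (M : ℝ) (N k : ℕ) : E d → ℂ :=
  convolution (h M N k) (dilate η k) (ContinuousLinearMap.mul ℂ ℂ) volume

/-- Peetre's maximal function `sup_y |g(x+y)| / (1 + r|y|)^σ`, with values in `[0,∞]`. -/
def peetreMax {d : ℕ} (σ r : ℝ) (g : E d → ℂ) (x : E d) : ℝ≥0∞ :=
  ⨆ y : E d, ‖g (x + y)‖ₑ / ENNReal.ofReal ((1 + r * ‖y‖) ^ σ)

/-- The (quasi-)norm `‖(∑_{k=N}^{2^{Nd}} G_k^q)^{1/q}‖_p` over `ℝ^d` of nonnegative functions. -/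
def mixedNorm {d : ℕ} (p q : ℝ) (N : ℕ) (G : ℕ → E d → ℝ≥0∞) : ℝ≥0∞ :=
  eLpNorm (fun x => (∑ k ∈ Finset.Icc N (2 ^ (N * d)), G k x ^ q) ^ (1 / q))
    (ENNReal.ofReal p) volume

end DyadicPeetre

end

namespace DyadicPeetre

variable {d : ℕ}

/-! For (i), Schwartz decay reduces everything to counting. As `M > 0`, each cube `Q_{k,j}` lies in
the dyadic cube of side `2^{-k}` with index `2^N j`. Sorting the cubes by their position `v`
relative to `x` bounds `|f_k|` by a rapidly convergent sum over `v` of characteristic functions of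
the sets `gridSet N k v`, so it suffices to bound the moments of `∑_k χ_k` uniformly in `N` and `v`.
Each set has measure `2^{-Nd}` and there are at most `2^{Nd} + 1` values of `k`, which settles the
first moment. For higher moments the scales decorrelate: inside a dyadic cube of generation `l ≤ k`
the set has density at most `2^{-Nd} + 2^{-(k-l)d}` (`volume_inter_gridSet_le`), and summing this
over `k` gives at most 4. Ordered products of `m + 1` factors thus have total integral at most `4^m
* 2` (`sum_lintegral_iterSum_le`).

For (ii), once `N` is large `|f_k| ≥ 2^{-Md}/2` on every `Q_{k,j}`: the cube's own contribution is
at least `2^{-Md}` and the others add up to `O(2^{-N(d+1)})`. Enlarging the cubes to side `2^{m-k}`,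
`m ≤ N`, costs the maximal function only a factor `2^{-mσ}` (`le_peetreMax`). At `m = N` the
enlarged cubes tile the unit cube, and the roughly `2^{Nd}` values of `k` produce `2^{N(d/q-σ)}`.
For the other term, `σ ≤ d/q` bounds the `q`-th power below by a multiple of `∑_m 2^{-md} χ_m`. Each
of the `N + 1` scales integrates to `2^{-Nd}`, so summing over `k` gives a multiple of `N`. Hölder
on the unit cube passes from `L^q` to `L^p`. -/

/-- The volume of a box in Euclidean space. -/
theorem volume_box (s : Fin d → Set ℝ) :
    volume {x : E d | ∀ i, x i ∈ s i} = ∏ i, volume (s i) := by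
  rw [← volume_pi_pi]
  have h := (PiLp.volume_preserving_ofLp (Fin d)).measure_preimage_emb
    (MeasurableEquiv.toLp 2 (Fin d → ℝ)).symm.measurableEmbedding (Set.univ.pi s)
  rw [← h]
  congr 1
  ext x
  simp [Set.mem_pi]

/-! ### Dyadic cubes and their indices. -/

/-- The index of the dyadic cube of side `2^{-k}` containing `x`. -/
noncomputable def idx (k : ℕ) (x : E d) : Fin d → ℤ := fun i => ⌊(2 : ℝ) ^ k * x i⌋

theorem measurable_idx (k : ℕ) : Measurable (idx k : E d → Fin d → ℤ) := by
  refine measurable_pi_lambda _ fun i => Int.measurable_floor.comp ?_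
  fun_prop

theorem idx_eq_iff (k : ℕ) (x : E d) (w : Fin d → ℤ) :
    idx k x = w ↔ ∀ i, x i ∈ Set.Ico ((w i : ℝ) / 2 ^ k) ((w i + 1 : ℝ) / 2 ^ k) := by
  have h2 : (0 : ℝ) < 2 ^ k := by positivity
  rw [funext_iff]
  refine forall_congr' fun i => ?_
  rw [idx, Int.floor_eq_iff, Set.mem_Ico, div_le_iff₀' h2, lt_div_iff₀' h2]

theorem volume_idx_preimage (k : ℕ) (w : Fin d → ℤ) :
    volume (idx k ⁻¹' {w} : Set (E d)) = ((2 : ℝ≥0∞) ^ (k * d))⁻¹ := by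
  have : (idx k ⁻¹' {w} : Set (E d)) =
      {x | ∀ i, x i ∈ Set.Ico ((w i : ℝ) / 2 ^ k) ((w i + 1 : ℝ) / 2 ^ k)} := by
    ext x
    exact idx_eq_iff k x w
  rw [this, volume_box]
  have h : ∀ i, volume (Set.Ico ((w i : ℝ) / 2 ^ k) ((w i + 1 : ℝ) / 2 ^ k))
      = ((2 : ℝ≥0∞) ^ k)⁻¹ := fun i => by
    rw [Real.volume_Ico, ← sub_div, add_sub_cancel_left, one_div,
      ENNReal.ofReal_inv_of_pos (by positivity), ENNReal.ofReal_pow (by norm_num)]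
    norm_num
  simp only [h, Finset.prod_const, Finset.card_univ, Fintype.card_fin]
  rw [pow_mul, ENNReal.inv_pow, ENNReal.inv_pow, ENNReal.inv_pow]

theorem idx_eq_ediv {l k : ℕ} (hlk : l ≤ k) (x : E d) :
    idx l x = fun i => idx k x i / 2 ^ (k - l) := by
  funext i
  have h := Int.floor_div_natCast ((2 : ℝ) ^ k * x i) (2 ^ (k - l))
  simp only [idx]
  push_cast at h
  rw [← h]
  congr 1
  rw [eq_div_iff (by positivity), mul_right_comm, ← pow_add, Nat.add_sub_cancel' hlk]

/-- Integration of a function of the dyadic index over a set. -/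
theorem lintegral_comp_idx (k : ℕ) (φ : (Fin d → ℤ) → ℝ≥0∞) (s : Set (E d)) :
    ∫⁻ x in s, φ (idx k x) = ∑' u, φ u * volume ((idx k ⁻¹' {u}) ∩ s) := by
  rw [← lintegral_map (μ := volume.restrict s) (f := φ) (.of_discrete) (measurable_idx k),
    lintegral_countable']
  refine tsum_congr fun u => ?_
  rw [Measure.map_apply (measurable_idx k) (measurableSet_singleton u),
    Measure.restrict_apply (measurable_idx k (measurableSet_singleton u))]

theorem lintegral_comp_idx_univ (k : ℕ) (φ : (Fin d → ℤ) → ℝ≥0∞) :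
    ∫⁻ x : E d, φ (idx k x) = ∑' u, φ u * ((2 : ℝ≥0∞) ^ (k * d))⁻¹ := by
  have h := lintegral_comp_idx (d := d) k φ Set.univ
  simpa only [Measure.restrict_univ, Set.inter_univ, volume_idx_preimage] using h

/-! ### Summation over the integer lattice with polynomial weights. -/

/-- The weight `1 + |v|` on the integer lattice. -/
noncomputable def W (v : Fin d → ℤ) : ℝ≥0∞ := ENNReal.ofReal (1 + ‖v‖)

theorem one_le_W (v : Fin d → ℤ) : 1 ≤ W v := by
  rw [W, ENNReal.one_le_ofReal]
  linarith [norm_nonneg v]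

theorem W_ne_zero (v : Fin d → ℤ) : W v ≠ 0 := (zero_lt_one.trans_le (one_le_W v)).ne'

theorem W_ne_top (v : Fin d → ℤ) : W v ≠ ∞ := ENNReal.ofReal_ne_top

theorem norm_le_sqrt_mul (x : E d) (b : ℝ) (hb : 0 ≤ b) (h : ∀ i, |x i| ≤ b) :
    ‖x‖ ≤ √d * b := by
  rw [EuclideanSpace.norm_eq, ← Real.sqrt_sq hb, ← Real.sqrt_mul (by positivity)]
  refine Real.sqrt_le_sqrt ((Finset.sum_le_sum (g := fun _ => b ^ 2) fun i _ => ?_).trans ?_)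
  · rw [Real.norm_eq_abs]
    exact pow_le_pow_left₀ (abs_nonneg _) (h i) 2
  · simp

/-- `∑_v (1+|v|)^{-d-1}`. -/
noncomputable def latticeSum (d : ℕ) : ℝ≥0∞ := ∑' v : Fin d → ℤ, W v ^ (-(d + 1 : ℝ))

/-- The sum is an integral over unit cubes, on which `W` is comparable to `1 + ‖x‖`; the integral of
`(1 + ‖x‖)^{-d-1}` is finite. -/
theorem latticeSum_ne_top : latticeSum d ≠ ∞ := by
  have h := finite_integral_one_add_norm (E := E d) (μ := volume) (r := d + 1)
    (by simp)
  have h1 := lintegral_comp_idx_univ (d := d) 0 (fun v => W v ^ (-(d + 1 : ℝ)))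
  simp only [zero_mul, pow_zero, inv_one, mul_one] at h1
  rw [latticeSum, ← h1]
  have hc : (0 : ℝ) < 1 + √d := by positivity
  refine ne_top_of_le_ne_top (ENNReal.mul_ne_top
    (ENNReal.ofReal_ne_top (r := (1 + √d) ^ (d + 1 : ℝ))) h.ne) ?_
  rw [← lintegral_const_mul' _ _ ENNReal.ofReal_ne_top]
  refine lintegral_mono fun x => ?_
  have hn : 0 < 1 + ‖idx 0 x‖ := by positivity
  rw [W, ENNReal.ofReal_rpow_of_pos hn, ← ENNReal.ofReal_mul (by positivity)]
  refine ENNReal.ofReal_le_ofReal ?_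
  have hx : ‖x‖ ≤ √d * (1 + ‖idx 0 x‖) := by
    refine norm_le_sqrt_mul x _ hn.le fun i => ?_
    have h2 := norm_le_pi_norm (idx 0 x) i
    rw [Int.norm_eq_abs] at h2
    simp only [idx, pow_zero, one_mul] at h2 ⊢
    have h3 := Int.floor_le (x i)
    have h4 := Int.lt_floor_add_one (x i)
    rw [abs_le] at h2 ⊢
    constructor <;> linarith
  have h5 : 1 + ‖x‖ ≤ (1 + √d) * (1 + ‖idx 0 x‖) := by nlinarith [norm_nonneg (idx 0 x)]
  rw [Real.rpow_neg hn.le, Real.rpow_neg (by positivity), ← div_eq_mul_inv,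
    le_div_iff₀ (by positivity), inv_mul_le_iff₀ (by positivity), mul_comm (_ ^ _),
    ← Real.mul_rpow hc.le hn.le]
  exact Real.rpow_le_rpow (by positivity) h5 (by positivity)

/-- Powers of a sum are controlled by the weighted sum of powers. -/
theorem tsum_rpow_le (a : (Fin d → ℤ) → ℝ≥0∞) {s : ℝ} (hs : 0 < s) :
    (∑' v, a v) ^ s ≤ latticeSum d ^ s * ∑' v, (W v ^ (d + 1 : ℝ) * a v) ^ s := by
  set T := ∑' v, (W v ^ (d + 1 : ℝ) * a v) ^ s with hT
  have h1 : ∑' v, a v ≤ latticeSum d * T ^ (1 / s) := by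
    rw [latticeSum, ← ENNReal.tsum_mul_right]
    refine ENNReal.tsum_le_tsum fun v => ?_
    -- Bounding one term by the whole sum treats `s ≤ 1` and `s ≥ 1` alike, at the price of the
    -- weight.
    have h2 : W v ^ (d + 1 : ℝ) * a v ≤ T ^ (1 / s) := by
      rw [one_div, ENNReal.le_rpow_inv_iff hs]
      exact ENNReal.le_tsum v
    calc a v = W v ^ (-(d + 1 : ℝ)) * (W v ^ (d + 1 : ℝ) * a v) := by
          rw [← mul_assoc, ← ENNReal.rpow_add _ _ (W_ne_zero v) (W_ne_top v)]
          simp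
      _ ≤ _ := by gcongr
  calc (∑' v, a v) ^ s ≤ (latticeSum d * T ^ (1 / s)) ^ s := by gcongr
    _ = _ := by
      rw [ENNReal.mul_rpow_of_nonneg _ _ hs.le, ← ENNReal.rpow_mul, one_div_mul_cancel hs.ne',
        ENNReal.rpow_one]

/-! ### Periodic grids of dyadic cubes and their density. -/

/-- The multi-indices `{0, …, 2^{k-N}-1}^d`. -/
def box (d N k : ℕ) : Finset (Fin d → ℕ) :=
  Fintype.piFinset (fun _ : Fin d => Finset.range (2 ^ (k - N)))

/-- The dyadic index of the lower corner of `Q_{k,j}`. -/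
def corner (N : ℕ) (j : Fin d → ℕ) : Fin d → ℤ := fun i => 2 ^ N * (j i : ℤ)

theorem corner_injective (N : ℕ) : Function.Injective (corner N : (Fin d → ℕ) → _) := by
  intro j j' h
  funext i
  have := congrFun h i
  simpa [corner] using this

/-- The union of the dyadic cubes with indices `v + 2^N j`. -/
def gridSet (N k : ℕ) (v : Fin d → ℤ) : Set (E d) :=
  idx k ⁻¹' {w | ∃ j ∈ box d N k, w = v + corner N j}

theorem measurableSet_gridSet (N k : ℕ) (v : Fin d → ℤ) : MeasurableSet (gridSet N k v) :=
  measurable_idx k (.of_discrete)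

/-- The characteristic function of `gridSet`. -/
noncomputable def chi (N k : ℕ) (v : Fin d → ℤ) : E d → ℝ≥0∞ := (gridSet N k v).indicator 1

theorem volume_le_card (k : ℕ) (S : Finset (Fin d → ℤ)) (t : Set (E d))
    (h : ∀ x ∈ t, idx k x ∈ S) : volume t ≤ S.card * ((2 : ℝ≥0∞) ^ (k * d))⁻¹ := by
  calc volume t ≤ volume (⋃ w ∈ S, (idx k ⁻¹' {w} : Set (E d))) := by
        refine measure_mono fun x hx => ?_
        simpa using h x hx
    _ ≤ ∑ w ∈ S, volume (idx k ⁻¹' {w} : Set (E d)) := measure_biUnion_finset_le _ _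
    _ = _ := by simp [volume_idx_preimage]

theorem card_box (N k : ℕ) : (box d N k).card = 2 ^ ((k - N) * d) := by
  simp [box, pow_mul]

theorem volume_gridSet {N k : ℕ} (h : N ≤ k) (v : Fin d → ℤ) :
    volume (gridSet N k v) = ((2 : ℝ≥0∞) ^ (N * d))⁻¹ := by
  have h1 : gridSet N k v = ⋃ j ∈ box d N k, (idx k ⁻¹' {v + corner N j} : Set (E d)) := by
    ext x
    simp [gridSet]
  rw [h1, measure_biUnion_finset]
  · simp only [volume_idx_preimage, Finset.sum_const, card_box, nsmul_eq_mul]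
    obtain ⟨e, rfl⟩ := Nat.exists_eq_add_of_le h
    rw [Nat.add_sub_cancel_left, add_mul, add_comm, pow_add,
      ENNReal.mul_inv (by simp) (by simp), ← mul_assoc]
    push_cast
    rw [ENNReal.mul_inv_cancel (by simp) (by simp), one_mul]
  · intro j _ j' _ hj
    refine Disjoint.preimage _ (Set.disjoint_singleton.2 fun hjj => hj ?_)
    exact corner_injective N (add_left_cancel hjj)
  · exact fun j _ => measurable_idx k (measurableSet_singleton _)

theorem card_filter_modEq_le (a v : ℤ) (n N : ℕ) :
    ((Finset.Ico a (a + 2 ^ n)).filter (fun x => x ≡ v [ZMOD 2 ^ N])).card ≤ 2 ^ (n - N) := by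
  -- If `n < N` the interval is lengthened to one full period, so the count is an exact power of two
  -- in both cases.
  obtain ⟨e, he⟩ := Nat.exists_eq_add_of_le (le_max_right n N)
  have h1 : n - N = e := by omega
  have h2 : (a + 2 ^ n : ℤ) ≤ a + 2 ^ (N + e) := by
    rw [← he]
    gcongr
    · norm_num
    · exact le_max_left _ _
  refine (Finset.card_le_card (Finset.filter_subset_filter _
    (Finset.Ico_subset_Ico_right h2))).trans ?_
  have h3 := Int.Ico_filter_modEq_card a (a + 2 ^ (N + e)) (r := 2 ^ N) (by positivity) v
  have h4 : ((a + 2 ^ (N + e) : ℤ) - v : ℚ) / ((2 ^ N : ℤ) : ℚ)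
      = (a - v : ℚ) / ((2 ^ N : ℤ) : ℚ) + ((2 ^ e : ℕ) : ℚ) := by
    push_cast
    rw [pow_add]
    field_simp
    ring
  rw [h4, Int.ceil_add_natCast, add_sub_cancel_left, max_eq_left (by positivity)] at h3
  rw [h1]
  exact_mod_cast h3.le

/-- Decorrelation: the density of `gridSet N k v` in a larger dyadic cube. -/
theorem volume_inter_gridSet_le {N l k : ℕ} (hlk : l ≤ k) (u v : Fin d → ℤ) :
    volume ((idx l ⁻¹' {u}) ∩ gridSet N k v : Set (E d)) ≤
      (((2 : ℝ≥0∞) ^ (N * d))⁻¹ + ((2 : ℝ≥0∞) ^ ((k - l) * d))⁻¹) *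
        ((2 : ℝ≥0∞) ^ (l * d))⁻¹ := by
  classical
  obtain ⟨n, rfl⟩ := Nat.exists_eq_add_of_le hlk
  rw [Nat.add_sub_cancel_left]
  -- Only the congruence modulo `2^N` is kept; the range of `j` is discarded.
  refine (volume_le_card (l + n) (Fintype.piFinset fun i =>
    (Finset.Ico (u i * 2 ^ n) (u i * 2 ^ n + 2 ^ n)).filter (fun x => x ≡ v i [ZMOD 2 ^ N]))
    _ ?_).trans ?_
  · rintro x ⟨hx, j, hj, hj'⟩
    rw [Fintype.mem_piFinset]
    intro i
    rw [Finset.mem_filter, Finset.mem_Ico]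
    refine ⟨?_, ?_⟩
    · have h1 : idx (l + n) x i / 2 ^ n = u i := by
        have h2 := congrFun (idx_eq_ediv hlk x) i
        rw [Nat.add_sub_cancel_left] at h2
        rw [← h2, hx]
      have h3 := Int.mul_ediv_add_emod (idx (l + n) x i) (2 ^ n)
      have h4 := Int.emod_nonneg (idx (l + n) x i) (b := 2 ^ n) (by positivity)
      have h5 := Int.emod_lt_of_pos (idx (l + n) x i) (b := 2 ^ n) (by positivity)
      rw [h1] at h3
      constructor <;> linarith
    · rw [hj']
      exact (Int.modEq_iff_dvd.2 (by simp [corner])).symm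
  · have hcard : ((Fintype.piFinset fun i =>
        (Finset.Ico (u i * 2 ^ n) (u i * 2 ^ n + 2 ^ n)).filter
          (fun x => x ≡ v i [ZMOD 2 ^ N])).card : ℝ≥0∞) ≤ (2 : ℝ≥0∞) ^ ((n - N) * d) := by
      rw [Fintype.card_piFinset]
      have := Finset.prod_le_prod' (s := Finset.univ) fun (i : Fin d) _ =>
        card_filter_modEq_le (u i * 2 ^ n) (v i) n N
      rw [Finset.prod_const, Finset.card_univ, Fintype.card_fin, ← pow_mul] at this
      exact_mod_cast this
    refine (mul_le_mul_left hcard _).trans ?_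
    rw [add_mul, pow_add, ENNReal.mul_inv (by simp) (by simp), mul_comm (_⁻¹) (_⁻¹), ← mul_assoc]
    gcongr
    -- For `n ≤ N` at most one subcube can occur, which gives the second summand; for `n ≥ N` the
    -- residue density gives the first.
    rcases le_total n N with h | h
    · rw [Nat.sub_eq_zero_of_le h, zero_mul, pow_zero, one_mul]
      exact le_add_self
    · obtain ⟨e, rfl⟩ := Nat.exists_eq_add_of_le h
      rw [Nat.add_sub_cancel_left, add_mul N, add_comm, pow_add, ENNReal.mul_inv (by simp) (by simp),
        ← mul_assoc, ENNReal.mul_inv_cancel (by simp) (by simp), one_mul]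
      exact le_self_add

theorem lintegral_chi_mul_le {N l k : ℕ} (hlk : l ≤ k) (v : Fin d → ℤ)
    (φ : (Fin d → ℤ) → ℝ≥0∞) :
    ∫⁻ x : E d, chi N k v x * φ (idx l x) ≤
      (((2 : ℝ≥0∞) ^ (N * d))⁻¹ + ((2 : ℝ≥0∞) ^ ((k - l) * d))⁻¹) *
        ∫⁻ x : E d, φ (idx l x) := by
  have h1 : ∀ x : E d, chi N k v x * φ (idx l x)
      = (gridSet N k v).indicator (fun x => φ (idx l x)) x := fun x => by
    by_cases hx : x ∈ gridSet N k v <;> simp [chi, hx]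
  simp only [h1]
  rw [lintegral_indicator (measurableSet_gridSet N k v), lintegral_comp_idx,
    lintegral_comp_idx_univ, ← ENNReal.tsum_mul_left]
  refine ENNReal.tsum_le_tsum fun u => ?_
  rw [mul_left_comm]
  gcongr
  exact volume_inter_gridSet_le hlk u v

/-! ### Moments of the overlap function. -/

/-- The ordered iterated sums of products of `chi`. -/
noncomputable def iterSum (N : ℕ) (v : Fin d → ℤ) : ℕ → ℕ → E d → ℝ≥0∞
  | 0, k, x => chi N k v x
  | m + 1, k, x => chi N k v x * ∑ l ∈ Finset.Icc N k, iterSum N v m l x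

/-- Only generations up to `k` enter, and their indices are determined by `idx k x`. This is what
makes the density bound applicable to the iterated sums. -/
theorem exists_iterSum_eq (N : ℕ) (v : Fin d → ℤ) (m k : ℕ) :
    ∃ φ : (Fin d → ℤ) → ℝ≥0∞, ∀ x : E d, iterSum N v m k x = φ (idx k x) := by
  classical
  have hchi : ∀ x : E d, chi N k v x
      = Set.indicator {w | ∃ j ∈ box d N k, w = v + corner N j} 1 (idx k x) := fun x => rfl
  induction m generalizing k with
  | zero => exact ⟨_, hchi⟩
  | succ m ih =>
    choose φ hφ using fun l => ih l (fun x => rfl)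
    refine ⟨fun w => Set.indicator {w | ∃ j ∈ box d N k, w = v + corner N j} 1 w *
      ∑ l ∈ Finset.Icc N k, φ l (fun i => w i / 2 ^ (k - l)), fun x => ?_⟩
    rw [iterSum, hchi]
    congr 1
    refine Finset.sum_congr rfl fun l hl => ?_
    rw [hφ, idx_eq_ediv (Finset.mem_Icc.1 hl).2]

theorem measurable_iterSum (N : ℕ) (v : Fin d → ℤ) (m k : ℕ) :
    Measurable (iterSum N v m k : E d → ℝ≥0∞) := by
  obtain ⟨φ, hφ⟩ := exists_iterSum_eq N v m k
  rw [funext hφ]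
  exact (Measurable.of_discrete (f := φ)).comp (measurable_idx k)

theorem lintegral_iterSum_succ_le (N : ℕ) (v : Fin d → ℤ) (m k : ℕ) :
    ∫⁻ x : E d, iterSum N v (m + 1) k x ≤ ∑ l ∈ Finset.Icc N k,
      (((2 : ℝ≥0∞) ^ (N * d))⁻¹ + ((2 : ℝ≥0∞) ^ ((k - l) * d))⁻¹) *
        ∫⁻ x : E d, iterSum N v m l x := by
  simp only [iterSum, Finset.mul_sum]
  rw [lintegral_finsetSum]
  · refine Finset.sum_le_sum fun l hl => ?_
    obtain ⟨φ, hφ⟩ := exists_iterSum_eq N v m l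
    simp only [hφ]
    exact lintegral_chi_mul_le (Finset.mem_Icc.1 hl).2 v φ
  · intro l _
    exact (measurable_iterSum N v 0 k).mul (measurable_iterSum N v m l)

theorem card_mul_le (d N l : ℕ) :
    ((Finset.Icc l (2 ^ (N * d))).card : ℝ≥0∞) * ((2 : ℝ≥0∞) ^ (N * d))⁻¹ ≤ 2 := by
  rw [← div_eq_mul_inv, ENNReal.div_le_iff (by simp) (by simp), Nat.card_Icc]
  have h : 2 ^ (N * d) + 1 - l ≤ 2 * 2 ^ (N * d) := by
    have := Nat.one_le_two_pow (n := N * d)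
    omega
  exact_mod_cast h

theorem sum_inv_two_pow_le (hd : 0 < d) (l T : ℕ) :
    ∑ k ∈ Finset.Icc l T, ((2 : ℝ≥0∞) ^ ((k - l) * d))⁻¹ ≤ 2 := by
  calc ∑ k ∈ Finset.Icc l T, ((2 : ℝ≥0∞) ^ ((k - l) * d))⁻¹
      ≤ ∑ k ∈ Finset.Icc l T, (2⁻¹ : ℝ≥0∞) ^ (k - l) := by
        refine Finset.sum_le_sum fun k _ => ?_
        rw [← ENNReal.inv_pow]
        gcongr
        · norm_num
        · exact Nat.le_mul_of_pos_right _ hd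
    _ = ∑ n ∈ (Finset.Icc l T).image (fun k => k - l), (2⁻¹ : ℝ≥0∞) ^ n := by
        rw [Finset.sum_image]
        intro a ha b hb hab
        simp only [Finset.coe_Icc, Set.mem_Icc] at ha hb hab
        omega
    _ ≤ ∑' n, (2⁻¹ : ℝ≥0∞) ^ n := ENNReal.sum_le_tsum _
    _ = 2 := by rw [ENNReal.tsum_geometric]; simp

/-- After interchanging the sums over `l ≤ k`, each step costs the sum over `k` of the two density
terms: at most 2 from the number of scales and 2 from a geometric series. -/
theorem sum_lintegral_iterSum_le (hd : 0 < d) (N : ℕ) (v : Fin d → ℤ) (m : ℕ) :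
    ∑ k ∈ Finset.Icc N (2 ^ (N * d)), ∫⁻ x : E d, iterSum N v m k x ≤ 4 ^ m * 2 := by
  induction m with
  | zero =>
    rw [pow_zero, one_mul]
    refine le_trans ?_ (card_mul_le d N N)
    rw [← nsmul_eq_mul]
    refine Finset.sum_le_card_nsmul _ _ _ fun k hk => ?_
    simp only [iterSum, chi]
    rw [lintegral_indicator_one (measurableSet_gridSet N k v)]
    exact (volume_gridSet (Finset.mem_Icc.1 hk).1 v).le
  | succ m ih =>
    refine (Finset.sum_le_sum fun k _ => lintegral_iterSum_succ_le N v m k).trans ?_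
    rw [Finset.sum_comm' (t' := Finset.Icc N (2 ^ (N * d)))
      (s' := fun l => Finset.Icc l (2 ^ (N * d)))
      (by intro x y; simp only [Finset.mem_Icc]; omega)]
    rw [pow_succ', mul_assoc]
    refine le_trans ?_ (mul_le_mul_right ih 4)
    rw [Finset.mul_sum]
    refine Finset.sum_le_sum fun l _ => ?_
    rw [← Finset.sum_mul, Finset.sum_add_distrib, Finset.sum_const, nsmul_eq_mul]
    gcongr
    refine (add_le_add (card_mul_le d N l) (sum_inv_two_pow_le hd l _)).trans ?_
    norm_num

theorem add_pow_succ_le (S a : ℝ≥0∞) (n : ℕ) :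
    (S + a) ^ (n + 1) ≤ S ^ (n + 1) + (n + 1 : ℕ) * (a * (S + a) ^ n) := by
  induction n with
  | zero => simp
  | succ n ih =>
    calc (S + a) ^ (n + 1 + 1) = S * (S + a) ^ (n + 1) + a * (S + a) ^ (n + 1) := by
          rw [pow_succ', add_mul]
      _ ≤ S * (S ^ (n + 1) + (n + 1 : ℕ) * (a * (S + a) ^ n)) + a * (S + a) ^ (n + 1) := by
          gcongr
      _ = S ^ (n + 1 + 1) + ((n + 1 : ℕ) * (a * (S * (S + a) ^ n)) + a * (S + a) ^ (n + 1)) := by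
          ring
      _ ≤ S ^ (n + 1 + 1) + ((n + 1 : ℕ) * (a * ((S + a) * (S + a) ^ n))
            + a * (S + a) ^ (n + 1)) := by
          gcongr
          exact le_self_add
      _ = _ := by push_cast; ring

/-- Discrete form of `F^{n+1} = (n+1) ∫ F^n dF`: expand the power by its largest index.
`add_pow_succ_le` is the subtraction-free increment. -/
theorem sum_Icc_pow_le (a : ℕ → ℝ≥0∞) (N T n : ℕ) :
    (∑ l ∈ Finset.Icc N T, a l) ^ (n + 1) ≤
      (n + 1 : ℕ) * ∑ k ∈ Finset.Icc N T, a k * (∑ l ∈ Finset.Icc N k, a l) ^ n := by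
  induction T with
  | zero =>
    rcases Nat.eq_zero_or_pos N with rfl | h
    · simp only [Finset.Icc_self, Finset.sum_singleton]
      rw [pow_succ', Nat.cast_succ, add_mul, one_mul]
      exact le_add_self
    · rw [Finset.Icc_eq_empty (by omega)]
      simp
  | succ T ih =>
    rcases le_or_gt N (T + 1) with h | h
    · simp only [← Finset.insert_Icc_right_eq_Icc_add_one h]
      rw [Finset.sum_insert (by simp), Finset.sum_insert (by simp), add_comm, mul_add,
        ← Finset.insert_Icc_right_eq_Icc_add_one h, Finset.sum_insert (by simp),
        add_comm (a (T + 1)) (∑ l ∈ _, _), add_comm (_ * _) (_ * ∑ k ∈ _, _)]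
      exact (add_pow_succ_le _ _ n).trans (by gcongr)
    · rw [Finset.Icc_eq_empty (by omega)]
      simp

theorem sum_chi_pow_le (N : ℕ) (v : Fin d → ℤ) (m T : ℕ) (x : E d) :
    (∑ k ∈ Finset.Icc N T, chi N k v x) ^ (m + 1) ≤
      (m + 1).factorial * ∑ k ∈ Finset.Icc N T, iterSum N v m k x := by
  induction m generalizing T with
  | zero => simp [iterSum]
  | succ m ih =>
    refine (sum_Icc_pow_le _ N T (m + 1)).trans ?_
    rw [Nat.factorial_succ (m + 1), Nat.cast_mul, mul_assoc]
    gcongr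
    rw [Finset.mul_sum]
    refine Finset.sum_le_sum fun k _ => ?_
    rw [iterSum, mul_left_comm]
    gcongr
    exact ih k

theorem chi_eq_zero_or_one (N k : ℕ) (v : Fin d → ℤ) (x : E d) :
    chi N k v x = 0 ∨ chi N k v x = 1 := by
  by_cases hx : x ∈ gridSet N k v <;> simp [chi, hx]

/-- The sum is either 0 or at least 1, so raising the exponent does not decrease its powers. -/
theorem sum_chi_rpow_le (N : ℕ) (v : Fin d → ℤ) (T m : ℕ) {s : ℝ} (hs : 0 < s) (hsm : s ≤ m + 1)
    (x : E d) :
    (∑ k ∈ Finset.Icc N T, chi N k v x) ^ s ≤ (∑ k ∈ Finset.Icc N T, chi N k v x) ^ (m + 1) := by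
  by_cases h : ∀ k ∈ Finset.Icc N T, chi N k v x = 0
  · rw [Finset.sum_eq_zero h, ENNReal.zero_rpow_of_pos hs]
    exact zero_le
  · push Not at h
    obtain ⟨k, hk, hk'⟩ := h
    have h1 : 1 ≤ ∑ k ∈ Finset.Icc N T, chi N k v x := by
      rw [← (chi_eq_zero_or_one N k v x).resolve_left hk']
      exact Finset.single_le_sum (f := fun k => chi N k v x) (fun _ _ => zero_le) hk
    rw [← ENNReal.rpow_natCast]
    exact ENNReal.rpow_le_rpow_of_exponent_le h1 (by exact_mod_cast hsm)

theorem measurable_sum_chi (N : ℕ) (v : Fin d → ℤ) (T : ℕ) :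
    Measurable fun x : E d => ∑ k ∈ Finset.Icc N T, chi N k v x :=
  Finset.measurable_sum _ fun k _ => measurable_iterSum N v 0 k

/-- The moments of `∑_k χ_{A_k}` are bounded independently of `N` and of the shift `v`. -/
theorem lintegral_sum_chi_rpow_le (hd : 0 < d) (N : ℕ) (v : Fin d → ℤ) (m : ℕ) {s : ℝ}
    (hs : 0 < s) (hsm : s ≤ m + 1) :
    ∫⁻ x : E d, (∑ k ∈ Finset.Icc N (2 ^ (N * d)), chi N k v x) ^ s ≤
      (m + 1).factorial * (4 ^ m * 2) := by
  refine (lintegral_mono fun x => (sum_chi_rpow_le N v _ m hs hsm x).trans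
    (sum_chi_pow_le N v m _ x)).trans ?_
  rw [lintegral_const_mul' _ _ (ENNReal.natCast_ne_top _),
    lintegral_finsetSum _ fun k _ => measurable_iterSum N v m k]
  gcongr
  exact sum_lintegral_iterSum_le hd N v m

/-! ### Decomposition of `f_k` over cubes and the upper bound. -/

theorem mem_cube_iff {M : ℝ} {N k : ℕ} {j : Fin d → ℕ} {x : E d} :
    x ∈ cube M N k j ↔ ∀ i, (2 : ℝ) ^ N * j i ≤ 2 ^ k * x i ∧
      2 ^ k * x i ≤ 2 ^ N * j i + (2 : ℝ) ^ (-M) := by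
  have h0 : (2 : ℝ) ^ k ≠ 0 := by positivity
  have h1 : (2 : ℝ) ^ k * (2 : ℝ) ^ (-(k : ℤ) + (N : ℤ)) = 2 ^ N := by
    rw [zpow_add₀ (by norm_num), zpow_neg, zpow_natCast, zpow_natCast, mul_inv_cancel_left₀ h0]
  have h2 : (2 : ℝ) ^ k * (2 : ℝ) ^ (-(k : ℝ) - M) = 2 ^ (-M) := by
    rw [sub_eq_add_neg, Real.rpow_add (by norm_num), Real.rpow_neg (by norm_num),
      Real.rpow_natCast, mul_inv_cancel_left₀ h0]
  refine forall_congr' fun i => and_congr ?_ ?_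
  · rw [← mul_le_mul_iff_right₀ (show (0 : ℝ) < 2 ^ k by positivity), ← h1]
    ring_nf
  · rw [← mul_le_mul_iff_right₀ (show (0 : ℝ) < 2 ^ k by positivity), mul_add, h2, ← h1]
    ring_nf

theorem cube_eq (M : ℝ) (N k : ℕ) (j : Fin d → ℕ) :
    cube M N k j = {x : E d | ∀ i, x i ∈ Set.Icc ((j i : ℝ) * (2 : ℝ) ^ (-(k : ℤ) + (N : ℤ)))
      ((j i : ℝ) * (2 : ℝ) ^ (-(k : ℤ) + (N : ℤ)) + (2 : ℝ) ^ (-(k : ℝ) - M))} := rfl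

theorem measurableSet_cube (M : ℝ) (N k : ℕ) (j : Fin d → ℕ) :
    MeasurableSet (cube M N k j : Set (E d)) := by
  rw [cube_eq, Set.ofPred_forall]
  refine MeasurableSet.iInter fun i => ?_
  have : Measurable fun x : E d => x i := by fun_prop
  exact this measurableSet_Icc

theorem volume_cube (M : ℝ) (N k : ℕ) (j : Fin d → ℕ) :
    volume (cube M N k j : Set (E d)) = ENNReal.ofReal (((2 : ℝ) ^ (-(k : ℝ) - M)) ^ d) := by
  rw [cube_eq, volume_box]
  simp only [Real.volume_Icc, add_sub_cancel_left, Finset.prod_const, Finset.card_univ,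
    Fintype.card_fin]
  rw [ENNReal.ofReal_pow (by positivity)]

theorem two_pow_mul_volume_cube (M : ℝ) (k : ℕ) :
    (2 : ℝ) ^ (k * d) * ((2 : ℝ) ^ (-(k : ℝ) - M)) ^ d = ((2 : ℝ) ^ (-M)) ^ d := by
  rw [pow_mul, ← mul_pow]
  congr 1
  rw [sub_eq_add_neg, Real.rpow_add (by norm_num), Real.rpow_neg (by norm_num),
    Real.rpow_natCast, mul_inv_cancel_left₀ (by positivity)]

theorem continuous_dilate (η : 𝓢(E d, ℂ)) (k : ℕ) : Continuous (dilate η k) := by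
  unfold dilate
  have := η.continuous
  fun_prop

theorem integrable_dilate (η : 𝓢(E d, ℂ)) (k : ℕ) : Integrable (dilate η k) := by
  unfold dilate
  exact (η.integrable.comp_smul (by positivity)).const_mul _

/-- The contribution of one cube to `f_k`. -/
noncomputable def cubeTerm (η : 𝓢(E d, ℂ)) (M : ℝ) (N k : ℕ) (j : Fin d → ℕ) (x : E d) : ℂ :=
  ∫ t in cube M N k j, dilate η k (x - t)

theorem f_eq_sum (η : 𝓢(E d, ℂ)) (M : ℝ) (N k : ℕ) (x : E d) :
    f η M N k x = ∑ j ∈ box d N k, cubeTerm η M N k j x := by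
  have hi : Integrable fun t => dilate η k (x - t) := (integrable_dilate η k).comp_sub_left x
  unfold f cubeTerm convolution
  simp only [ContinuousLinearMap.mul_apply']
  simp_rw [← integral_indicator (measurableSet_cube M N k _)]
  rw [← integral_finsetSum _ fun j _ => hi.indicator (measurableSet_cube M N k j)]
  congr 1
  funext t
  rw [h, Finset.sum_mul]
  refine Finset.sum_congr rfl fun j _ => ?_
  by_cases ht : t ∈ cube M N k j <;> simp [ht]

theorem exists_decay (η : 𝓢(E d, ℂ)) (m : ℕ) :
    ∃ B : ℝ, 0 ≤ B ∧ ∀ y, (1 + ‖y‖) ^ m * ‖η y‖ ≤ B := by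
  refine ⟨2 ^ m * (Finset.Iic (m, 0)).sup (fun m => SchwartzMap.seminorm ℝ m.1 m.2) η,
    by positivity, fun y => ?_⟩
  simpa using SchwartzMap.one_add_le_sup_seminorm_apply (𝕜 := ℝ) (m := (m, 0)) le_rfl le_rfl η y

theorem norm_index_sub_le {M : ℝ} (hM : 0 < M) {N k : ℕ} {j : Fin d → ℕ} {x t : E d}
    (ht : t ∈ cube M N k j) : ‖idx k x - corner N j‖ ≤ 1 + ‖(2 : ℝ) ^ k • (x - t)‖ := by
  refine (pi_norm_le_iff_of_nonneg (by positivity)).2 fun i => ?_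
  have h1 := mem_cube_iff.1 ht i
  have h2 : (2 : ℝ) ^ (-M) ≤ 1 := Real.rpow_le_one_of_one_le_of_nonpos (by norm_num) (by linarith)
  have h3 := PiLp.norm_apply_le ((2 : ℝ) ^ k • (x - t)) i
  have h4 := Int.floor_le ((2 : ℝ) ^ k * x i)
  have h5 := Int.lt_floor_add_one ((2 : ℝ) ^ k * x i)
  rw [Int.norm_eq_abs]
  simp only [PiLp.smul_apply, PiLp.sub_apply, smul_eq_mul, Real.norm_eq_abs, Pi.sub_apply, idx,
    corner] at h3 ⊢
  push_cast
  rw [abs_le] at h3 ⊢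
  constructor <;> linarith [h1.1, h1.2]

/-- The factor `2^{kd}` of the dilate cancels against the volume of the cube, leaving `2^{-Md} ≤ 1`;
hence the constant does not depend on `M`. -/
theorem norm_cubeTerm_le (η : 𝓢(E d, ℂ)) {m : ℕ} {B : ℝ}
    (hB : ∀ y, (1 + ‖y‖) ^ m * ‖η y‖ ≤ B) {M : ℝ} (hM : 0 < M) (N k : ℕ) (j : Fin d → ℕ)
    (x : E d) :
    ‖cubeTerm η M N k j x‖ ≤ 2 ^ m * B / (1 + ‖idx k x - corner N j‖) ^ m := by
  set v := idx k x - corner N j with hv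
  have hB0 : 0 ≤ B := le_trans (by positivity) (hB 0)
  have hpt : ∀ t ∈ cube M N k j,
      ‖dilate η k (x - t)‖ ≤ 2 ^ (k * d) * (2 ^ m * B / (1 + ‖v‖) ^ m) := by
    intro t ht
    have h1 := norm_index_sub_le hM (x := x) ht
    rw [← hv] at h1
    rw [dilate, norm_mul]
    simp only [norm_pow, RCLike.norm_ofNat]
    gcongr
    rw [le_div_iff₀ (by positivity)]
    calc ‖η ((2 : ℝ) ^ k • (x - t))‖ * (1 + ‖v‖) ^ m
        ≤ ‖η ((2 : ℝ) ^ k • (x - t))‖ * (2 * (1 + ‖(2 : ℝ) ^ k • (x - t)‖)) ^ m := by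
          gcongr
          linarith [norm_nonneg ((2 : ℝ) ^ k • (x - t))]
      _ = 2 ^ m * ((1 + ‖(2 : ℝ) ^ k • (x - t)‖) ^ m * ‖η ((2 : ℝ) ^ k • (x - t))‖) := by
          rw [mul_pow]; ring
      _ ≤ _ := by gcongr; exact hB _
  have hvol := volume_cube (d := d) M N k j
  refine (norm_setIntegral_le_of_norm_le_const (by rw [hvol]; exact ENNReal.ofReal_lt_top)
    hpt).trans ?_
  rw [measureReal_def, hvol, ENNReal.toReal_ofReal (by positivity), mul_right_comm,
    two_pow_mul_volume_cube]
  refine mul_le_of_le_one_left (by positivity) (pow_le_one₀ (by positivity) ?_)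
  exact Real.rpow_le_one_of_one_le_of_nonpos (by norm_num) (by linarith)

theorem enorm_cubeTerm_le (η : 𝓢(E d, ℂ)) {m : ℕ} {B : ℝ}
    (hB : ∀ y, (1 + ‖y‖) ^ m * ‖η y‖ ≤ B) {M : ℝ} (hM : 0 < M) (N k : ℕ) (j : Fin d → ℕ)
    (x : E d) :
    ‖cubeTerm η M N k j x‖ₑ ≤
      ENNReal.ofReal (2 ^ m * B) * W (idx k x - corner N j) ^ (-(m : ℝ)) := by
  rw [← ofReal_norm, ENNReal.rpow_neg, ENNReal.rpow_natCast, W,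
    ← ENNReal.ofReal_pow (by positivity), ← ENNReal.ofReal_inv_of_pos (by positivity),
    ← ENNReal.ofReal_mul' (by positivity), ← div_eq_mul_inv]
  exact ENNReal.ofReal_le_ofReal (norm_cubeTerm_le η hB hM N k j x)

/-- Reindexing by the relative position `v` moves the dependence on `x` into `chi`, so that the
weights are the same for all `x` and `k`. -/
theorem sum_box_le_tsum (N k : ℕ) (g : (Fin d → ℤ) → ℝ≥0∞) (x : E d) :
    ∑ j ∈ box d N k, g (idx k x - corner N j) ≤ ∑' v, g v * chi N k v x := by
  classical
  calc ∑ j ∈ box d N k, g (idx k x - corner N j)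
      = ∑ j ∈ box d N k, (fun v => g v * chi N k v x) (idx k x - corner N j) := by
        refine Finset.sum_congr rfl fun j hj => ?_
        have : x ∈ gridSet N k (idx k x - corner N j) := ⟨j, hj, by simp⟩
        simp [chi, this]
    _ = ∑ v ∈ (box d N k).image (fun j => idx k x - corner N j), g v * chi N k v x := by
        rw [Finset.sum_image]
        exact fun a _ b _ hab => corner_injective N (sub_right_injective hab)
    _ ≤ _ := ENNReal.sum_le_tsum _

theorem enorm_f_le (η : 𝓢(E d, ℂ)) {m : ℕ} {B : ℝ}
    (hB : ∀ y, (1 + ‖y‖) ^ m * ‖η y‖ ≤ B) {M : ℝ} (hM : 0 < M) (N k : ℕ) (x : E d) :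
    ‖f η M N k x‖ₑ ≤
      ∑' v, ENNReal.ofReal (2 ^ m * B) * W v ^ (-(m : ℝ)) * chi N k v x := by
  rw [f_eq_sum]
  refine (enorm_sum_le _ _).trans (le_trans (Finset.sum_le_sum fun j _ =>
    enorm_cubeTerm_le η hB hM N k j x) ?_)
  exact sum_box_le_tsum N k (fun v => ENNReal.ofReal (2 ^ m * B) * W v ^ (-(m : ℝ))) x

theorem enorm_f_rpow_le (η : 𝓢(E d, ℂ)) {m : ℕ} {B : ℝ}
    (hB : ∀ y, (1 + ‖y‖) ^ m * ‖η y‖ ≤ B) {M : ℝ} (hM : 0 < M) (N k : ℕ) (x : E d)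
    {q : ℝ} (hq : 0 < q) :
    ‖f η M N k x‖ₑ ^ q ≤ ∑' v, latticeSum d ^ q * ENNReal.ofReal (2 ^ m * B) ^ q *
      W v ^ ((d + 1 - m) * q) * chi N k v x := by
  refine (ENNReal.rpow_le_rpow (enorm_f_le η hB hM N k x) hq.le).trans
    ((tsum_rpow_le _ hq).trans ?_)
  rw [← ENNReal.tsum_mul_left]
  refine ENNReal.tsum_le_tsum fun v => le_of_eq ?_
  have h1 : chi N k v x ^ q = chi N k v x := by
    rcases chi_eq_zero_or_one N k v x with h | h <;> rw [h] <;> simp [hq]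
  rw [ENNReal.mul_rpow_of_nonneg _ _ hq.le, ENNReal.mul_rpow_of_nonneg _ _ hq.le, h1,
    ENNReal.mul_rpow_of_nonneg _ _ hq.le, ENNReal.rpow_mul _ (d + 1 - m : ℝ),
    sub_eq_add_neg (d + 1 : ℝ), ENNReal.rpow_add (d + 1 : ℝ) _ (W_ne_zero v) (W_ne_top v),
    ENNReal.mul_rpow_of_nonneg _ _ hq.le]
  ac_rfl

/-- Two applications of `tsum_rpow_le`, for the powers `q` and `s`, each losing a factor `W^{d+1}`
inside the power. -/
theorem sum_enorm_f_rpow_le (η : 𝓢(E d, ℂ)) {m : ℕ} {B : ℝ}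
    (hB : ∀ y, (1 + ‖y‖) ^ m * ‖η y‖ ≤ B) {M : ℝ} (hM : 0 < M) (N T : ℕ) (x : E d)
    {q s : ℝ} (hq : 0 < q) (hs : 0 < s) :
    (∑ k ∈ Finset.Icc N T, ‖f η M N k x‖ₑ ^ q) ^ s ≤
      latticeSum d ^ s * ∑' v, (latticeSum d ^ q * ENNReal.ofReal (2 ^ m * B) ^ q) ^ s *
        W v ^ ((d + 1 + (d + 1 - m) * q) * s) * (∑ k ∈ Finset.Icc N T, chi N k v x) ^ s := by
  have h1 : ∑ k ∈ Finset.Icc N T, ‖f η M N k x‖ₑ ^ q ≤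
      ∑' v, latticeSum d ^ q * ENNReal.ofReal (2 ^ m * B) ^ q *
        W v ^ ((d + 1 - m) * q) * ∑ k ∈ Finset.Icc N T, chi N k v x := by
    refine (Finset.sum_le_sum fun k _ => enorm_f_rpow_le η hB hM N k x hq).trans ?_
    rw [← Summable.tsum_finsetSum fun _ _ => ENNReal.summable]
    simp only [Finset.mul_sum]
    exact le_rfl
  refine (ENNReal.rpow_le_rpow h1 hs.le).trans ((tsum_rpow_le _ hs).trans ?_)
  gcongr with v
  rw [← mul_assoc, ENNReal.mul_rpow_of_nonneg _ _ hs.le, mul_left_comm,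
    ENNReal.mul_rpow_of_nonneg _ _ hs.le, ← ENNReal.rpow_add _ _ (W_ne_zero v) (W_ne_top v),
    ← ENNReal.rpow_mul]

theorem mixedNorm_eq {p q : ℝ} (hp : 0 < p) (N : ℕ) (G : ℕ → E d → ℝ≥0∞) :
    mixedNorm p q N G =
      (∫⁻ x, (∑ k ∈ Finset.Icc N (2 ^ (N * d)), G k x ^ q) ^ (p / q)) ^ (1 / p) := by
  rw [mixedNorm, eLpNorm_eq_lintegral_rpow_enorm_toReal (by simpa using hp) ENNReal.ofReal_ne_top,
    ENNReal.toReal_ofReal hp.le]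
  simp only [enorm_eq_self, ← ENNReal.rpow_mul, one_div_mul_eq_div]

/-- The upper bound for the square function of the `f_k`. -/
theorem exists_mixedNorm_f_le (hd : 0 < d) {p q : ℝ} (hq : 0 < q) (hqp : q ≤ p) (η : 𝓢(E d, ℂ)) :
    ∃ C : ℝ, ∀ M : ℝ, 0 < M → ∀ N : ℕ,
      mixedNorm p q N (fun k x => ‖f η M N k x‖ₑ) ≤ ENNReal.ofReal C := by
  have hp : 0 < p := hq.trans_le hqp
  set s := p / q
  have hs1 : 1 ≤ s := (one_le_div hq).2 hqp
  have hs : 0 < s := by linarith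
  -- Enough decay to absorb both weight losses and still leave the exponent at most `-(d+1)`.
  obtain ⟨m, hm⟩ := exists_nat_ge ((d + 1 : ℝ) + 2 * (d + 1) / q)
  obtain ⟨B, -, hB⟩ := exists_decay η m
  obtain ⟨n, hn⟩ := exists_nat_ge s
  have hexp : (d + 1 + (d + 1 - m) * q) * s ≤ -(d + 1 : ℝ) := by
    have h1 : 2 * (d + 1 : ℝ) ≤ (m - (d + 1)) * q := by
      rw [← div_le_iff₀ hq]
      linarith
    have h2 : (0 : ℝ) ≤ d + 1 := by positivity
    nlinarith
  set A := (latticeSum d ^ q * ENNReal.ofReal (2 ^ m * B) ^ q) ^ s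
  set D : ℝ≥0∞ := (n + 1).factorial * (4 ^ n * 2)
  set Q := latticeSum d ^ s * (A * D * latticeSum d)
  have hA : A ≠ ∞ := ENNReal.rpow_ne_top_of_nonneg hs.le (ENNReal.mul_ne_top
    (ENNReal.rpow_ne_top_of_nonneg hq.le latticeSum_ne_top)
    (ENNReal.rpow_ne_top_of_nonneg hq.le ENNReal.ofReal_ne_top))
  have hQ : Q ≠ ∞ := by
    refine ENNReal.mul_ne_top (ENNReal.rpow_ne_top_of_nonneg hs.le latticeSum_ne_top)
      (ENNReal.mul_ne_top (ENNReal.mul_ne_top hA ?_) latticeSum_ne_top)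
    exact ENNReal.mul_ne_top (ENNReal.natCast_ne_top _)
      (ENNReal.mul_ne_top (ENNReal.pow_ne_top (by simp)) (by simp))
  refine ⟨(Q ^ (1 / p)).toReal, fun M hM N => ?_⟩
  rw [ENNReal.ofReal_toReal (ENNReal.rpow_ne_top_of_nonneg (by positivity) hQ), mixedNorm_eq hp]
  gcongr
  refine (lintegral_mono fun x =>
    sum_enorm_f_rpow_le η hB hM N (2 ^ (N * d)) x hq hs).trans ?_
  have hmeas : ∀ v : Fin d → ℤ, Measurable fun x : E d =>
      (∑ k ∈ Finset.Icc N (2 ^ (N * d)), chi N k v x) ^ s :=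
    fun v => (measurable_sum_chi N v _).pow_const s
  rw [lintegral_const_mul' _ _ (ENNReal.rpow_ne_top_of_nonneg hs.le latticeSum_ne_top),
    lintegral_tsum fun v => ((hmeas v).const_mul _).aemeasurable]
  simp only [Q]
  gcongr
  rw [latticeSum, ← ENNReal.tsum_mul_left]
  refine ENNReal.tsum_le_tsum fun v => ?_
  rw [lintegral_const_mul _ (hmeas v)]
  calc _ ≤ A * W v ^ (-(d + 1 : ℝ)) * D := by
        exact mul_le_mul' (mul_le_mul_right
          (ENNReal.rpow_le_rpow_of_exponent_le (one_le_W v) hexp) A)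
          (lintegral_sum_chi_rpow_le hd N v n hs (by linarith))
    _ = _ := by ring

/-! ### Lower bound for `f_k` on the cubes. -/

theorem idx_eq_corner {M : ℝ} (hM : 0 < M) {N k : ℕ} {j : Fin d → ℕ} {x : E d}
    (hx : x ∈ cube M N k j) : idx k x = corner N j := by
  have h2 : (2 : ℝ) ^ (-M) < 1 := Real.rpow_lt_one_of_one_lt_of_neg (by norm_num) (by linarith)
  funext i
  have h1 := mem_cube_iff.1 hx i
  rw [idx, corner, Int.floor_eq_iff]
  push_cast
  constructor <;> linarith [h1.1, h1.2]

/-- For two points of one cube, the rescaled difference lies where `η ≥ 1`. The bound involves `M`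
but not `η`, as the constant in (ii) requires. -/
theorem le_norm_cubeTerm_self {η : 𝓢(E d, ℂ)} {M : ℝ} (hη : IsAdmissible M η) {N k : ℕ}
    {j : Fin d → ℕ} {x : E d} (hx : x ∈ cube M N k j) :
    ((2 : ℝ) ^ (-M)) ^ d ≤ ‖cubeTerm η M N k j x‖ := by
  have hi : Integrable fun t => dilate η k (x - t) := (integrable_dilate η k).comp_sub_left x
  have hvol := volume_cube (d := d) M N k j
  refine le_trans ?_ (Complex.re_le_norm _)
  have hre : (cubeTerm η M N k j x).re = ∫ t in cube M N k j, (dilate η k (x - t)).re :=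
    (integral_re (𝕜 := ℂ) hi.integrableOn).symm
  have hpt : ∀ t ∈ cube M N k j, (2 : ℝ) ^ (k * d) ≤ (dilate η k (x - t)).re := by
    intro t ht
    have h1 : 1 ≤ (η ((2 : ℝ) ^ k • (x - t))).re := by
      refine (hη.2 _ fun i => ?_).1
      have h2 := mem_cube_iff.1 hx i
      have h3 := mem_cube_iff.1 ht i
      simp only [PiLp.smul_apply, PiLp.sub_apply, smul_eq_mul]
      rw [abs_le]
      constructor <;> linarith [h2.1, h2.2, h3.1, h3.2]
    have h4 : ((2 : ℂ) ^ (k * d)) = (((2 : ℝ) ^ (k * d) : ℝ) : ℂ) := by push_cast; rfl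
    rw [dilate, h4, Complex.re_ofReal_mul]
    exact le_mul_of_one_le_right (by positivity) h1
  have hge := setIntegral_ge_of_const_le_real (measurableSet_cube M N k j)
    (by rw [hvol]; exact ENNReal.ofReal_ne_top) hpt hi.re.integrableOn
  rw [measureReal_def, hvol, ENNReal.toReal_ofReal (by positivity), two_pow_mul_volume_cube] at hge
  rw [hre]
  exact hge

theorem W_corner_sub_ge (N : ℕ) {j j' : Fin d → ℕ} (h : j ≠ j') :
    ENNReal.ofReal (2 ^ N / 2) * W (fun i => (j i : ℤ) - j' i) ≤ W (corner N j - corner N j') := by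
  rw [W, W, ← ENNReal.ofReal_mul (by positivity)]
  refine ENNReal.ofReal_le_ofReal ?_
  set v : Fin d → ℤ := fun i => (j i : ℤ) - j' i with hv
  have h1 : corner N j - corner N j' = (2 ^ N : ℤ) • v := by
    funext i
    simp [corner, hv, mul_sub]
  have h2 : ‖(2 ^ N : ℤ) • v‖ = 2 ^ N * ‖v‖ := by
    rw [norm_smul]
    simp [Int.norm_eq_abs]
  have h3 : 1 ≤ ‖v‖ := by
    obtain ⟨i, hi⟩ := Function.ne_iff.1 h
    refine le_trans ?_ (norm_le_pi_norm v i)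
    rw [Int.norm_eq_abs, ← Int.cast_abs]
    exact_mod_cast Int.one_le_abs (z := v i) (sub_ne_zero.2 (by exact_mod_cast hi))
  have h4 : (0 : ℝ) < 2 ^ N := by positivity
  rw [h1, h2]
  nlinarith

theorem sum_erase_cubeTerm_le (η : 𝓢(E d, ℂ)) {B : ℝ}
    (hB : ∀ y, (1 + ‖y‖) ^ (d + 1) * ‖η y‖ ≤ B) {M : ℝ} (hM : 0 < M) {N k : ℕ} {j : Fin d → ℕ}
    {x : E d} (hx : x ∈ cube M N k j) :
    ∑ j' ∈ (box d N k).erase j, ‖cubeTerm η M N k j' x‖ₑ ≤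
      ENNReal.ofReal (2 ^ (d + 1) * B) *
        (ENNReal.ofReal (2 ^ N / 2) ^ (-(d + 1 : ℝ)) * latticeSum d) := by
  classical
  calc ∑ j' ∈ (box d N k).erase j, ‖cubeTerm η M N k j' x‖ₑ
      ≤ ∑ j' ∈ (box d N k).erase j, ENNReal.ofReal (2 ^ (d + 1) * B) *
          (ENNReal.ofReal (2 ^ N / 2) ^ (-(d + 1 : ℝ)) *
            W (fun i => (j i : ℤ) - j' i) ^ (-(d + 1 : ℝ))) := by
        refine Finset.sum_le_sum fun j' hj' => (enorm_cubeTerm_le η hB hM N k j' x).trans ?_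
        gcongr
        rw [idx_eq_corner hM hx, ← ENNReal.mul_rpow_of_ne_top ENNReal.ofReal_ne_top (W_ne_top _)]
        push_cast
        rw [ENNReal.rpow_neg, ENNReal.rpow_neg, ENNReal.inv_le_inv]
        exact ENNReal.rpow_le_rpow (W_corner_sub_ge N (Finset.ne_of_mem_erase hj').symm)
          (by positivity)
    _ = ENNReal.ofReal (2 ^ (d + 1) * B) * (ENNReal.ofReal (2 ^ N / 2) ^ (-(d + 1 : ℝ)) *
          ∑ v ∈ ((box d N k).erase j).image (fun j' i => (j i : ℤ) - j' i),
            W v ^ (-(d + 1 : ℝ))) := by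
        rw [← Finset.mul_sum, ← Finset.mul_sum, Finset.sum_image]
        intro a _ b _ hab
        funext i
        have := congrFun hab i
        simpa using this
    _ ≤ _ := by
        gcongr
        exact ENNReal.sum_le_tsum _

/-- For large `N` the function `f_k` is bounded below on each cube `Q_{k,j}`. -/
theorem exists_le_enorm_f {η : 𝓢(E d, ℂ)} {M : ℝ} (hM : 0 < M) (hη : IsAdmissible M η) :
    ∃ N₀ : ℕ, ∀ N, N₀ ≤ N → ∀ k, ∀ j ∈ box d N k, ∀ x ∈ cube M N k j,
      ENNReal.ofReal (((2 : ℝ) ^ (-M)) ^ d / 2) ≤ ‖f η M N k x‖ₑ := by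
  obtain ⟨B, -, hB⟩ := exists_decay η (d + 1)
  set a : ℝ := ((2 : ℝ) ^ (-M)) ^ d
  have ha : 0 < a := by positivity
  have hlim : Filter.Tendsto (fun N : ℕ => ENNReal.ofReal (2 ^ (d + 1) * B) *
      (ENNReal.ofReal (2 ^ N / 2) ^ (-(d + 1 : ℝ)) * latticeSum d)) Filter.atTop (nhds 0) := by
    have h1 : Filter.Tendsto (fun N : ℕ => ENNReal.ofReal (2 ^ N / 2)) Filter.atTop (nhds ∞) :=
      ENNReal.tendsto_ofReal_atTop.comp
        ((tendsto_pow_atTop_atTop_of_one_lt (by norm_num : (1 : ℝ) < 2)).atTop_div_const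
          (by norm_num))
    have h2 := (ENNReal.continuous_rpow_const (y := (-(d + 1 : ℝ)))).tendsto ∞
    rw [ENNReal.top_rpow_of_neg (by linarith [(Nat.cast_nonneg d : (0 : ℝ) ≤ d)])] at h2
    have h3 := ENNReal.Tendsto.mul_const (b := latticeSum d) (h2.comp h1) (Or.inr latticeSum_ne_top)
    have h4 := ENNReal.Tendsto.const_mul (a := ENNReal.ofReal (2 ^ (d + 1) * B)) h3
      (Or.inr ENNReal.ofReal_ne_top)
    simpa using h4
  have hev := hlim.eventually (gt_mem_nhds (ENNReal.ofReal_pos.2 (half_pos ha)))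
  obtain ⟨N₀, hN₀⟩ := Filter.eventually_atTop.1 hev
  refine ⟨N₀, fun N hN k j hj x hx => ?_⟩
  have h1 : ENNReal.ofReal a ≤ ‖cubeTerm η M N k j x‖ₑ := by
    rw [← ofReal_norm]
    exact ENNReal.ofReal_le_ofReal (le_norm_cubeTerm_self hη hx)
  have h2 : cubeTerm η M N k j x =
      f η M N k x - ∑ j' ∈ (box d N k).erase j, cubeTerm η M N k j' x := by
    rw [f_eq_sum, ← Finset.add_sum_erase _ _ hj, add_sub_cancel_right]
  have h3 : ENNReal.ofReal a ≤ ‖f η M N k x‖ₑ + ENNReal.ofReal (a / 2) := by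
    refine h1.trans ?_
    rw [h2]
    refine enorm_sub_le.trans ?_
    gcongr
    exact (enorm_sum_le _ _).trans ((sum_erase_cubeTerm_le η hB hM hx).trans (hN₀ N hN).le)
  have h4 : ENNReal.ofReal (a / 2) = ENNReal.ofReal a - ENNReal.ofReal (a / 2) := by
    rw [← ENNReal.ofReal_sub _ (by positivity), sub_half]
  rw [h4]
  exact tsub_le_iff_right.2 h3

/-! ### Lower bounds for the Peetre square function. -/

/-- Pointwise lower bound of the Peetre maximal function at distance `2^{m-k}` from the cubes. -/
theorem le_peetreMax {η : 𝓢(E d, ℂ)} {M : ℝ} {a : ℝ} (ha : 0 < a) {N k m : ℕ}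
    (hf : ∀ j ∈ box d N k, ∀ x ∈ cube M N k j, ENNReal.ofReal a ≤ ‖f η M N k x‖ₑ)
    (hmN : m ≤ N) (hNk : N ≤ k) {q σ : ℝ} (hσ : 0 ≤ σ) (hσq : σ ≤ d / q) {x : E d}
    (hx : x ∈ gridSet (N - m) (k - m) 0) :
    ENNReal.ofReal (a * (1 + √d) ^ (-(d / q)) * (2 ^ m) ^ (-σ)) ≤
      peetreMax σ ((2 : ℝ) ^ k) (f η M N k) x := by
  obtain ⟨j, hj, hjx⟩ := hx
  obtain ⟨n, rfl⟩ := Nat.exists_eq_add_of_le hmN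
  obtain ⟨e, rfl⟩ := Nat.exists_eq_add_of_le hNk
  have hj' : j ∈ box d (m + n) (m + n + e) := by
    have : m + n + e - m - (m + n - m) = m + n + e - (m + n) := by omega
    rwa [box, this] at hj
  rw [zero_add, Nat.add_sub_cancel_left, add_assoc, Nat.add_sub_cancel_left] at hjx
  -- The common lower corner of `Q_{k,j}` and of the dyadic cube of side `2^{m-k}` containing `x`.
  set z : E d := WithLp.toLp 2 fun i => (2 : ℝ) ^ (m + n) * j i / 2 ^ (m + n + e) with hz
  have hzi : ∀ i, (2 : ℝ) ^ (m + n + e) * z i = 2 ^ (m + n) * j i := fun i => by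
    simp only [hz]
    field_simp
  have hzc : z ∈ cube M (m + n) (m + n + e) j := mem_cube_iff.2 fun i => by
    rw [hzi]
    exact ⟨le_rfl, le_add_of_nonneg_right (by positivity)⟩
  have hdist : (2 : ℝ) ^ (m + n + e) * ‖z - x‖ ≤ √d * 2 ^ m := by
    have h1 : ‖(2 : ℝ) ^ (m + n + e) • (z - x)‖ ≤ √d * 2 ^ m := by
      refine norm_le_sqrt_mul _ _ (by positivity) fun i => ?_
      have h2 := congrFun hjx i
      simp only [idx, corner] at h2
      rw [Int.floor_eq_iff] at h2
      push_cast at h2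
      have h3 : (0 : ℝ) < 2 ^ m := by positivity
      have h4 := mul_le_mul_of_nonneg_left h2.1 h3.le
      have h5 := mul_lt_mul_of_pos_left h2.2 h3
      rw [← mul_assoc, ← mul_assoc, ← pow_add, ← pow_add] at h4
      rw [← mul_assoc, mul_add, ← mul_assoc, ← pow_add, ← pow_add, mul_one] at h5
      simp only [PiLp.smul_apply, PiLp.sub_apply, smul_eq_mul]
      rw [mul_sub, hzi, add_assoc m n e, abs_le]
      constructor <;> linarith
    rwa [norm_smul, Real.norm_of_nonneg (by positivity)] at h1
  -- Replacing `σ` by `d / q` on the dimensional factor keeps the constant independent of `σ`.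
  have h6 : (1 + (2 : ℝ) ^ (m + n + e) * ‖z - x‖) ^ σ ≤ (1 + √d) ^ (d / q) * (2 ^ m) ^ σ := by
    have h7 : 1 + (2 : ℝ) ^ (m + n + e) * ‖z - x‖ ≤ (1 + √d) * 2 ^ m := by
      have : (1 : ℝ) ≤ 2 ^ m := one_le_pow₀ (by norm_num)
      linarith
    refine (Real.rpow_le_rpow (by positivity) h7 hσ).trans ?_
    rw [Real.mul_rpow (by positivity) (by positivity)]
    gcongr
    linarith [Real.sqrt_nonneg d]
  have h8 := le_iSup (fun y : E d => ‖f η M (m + n) (m + n + e) (x + y)‖ₑ /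
    ENNReal.ofReal ((1 + (2 : ℝ) ^ (m + n + e) * ‖y‖) ^ σ)) (z - x)
  refine le_trans ?_ h8
  rw [add_sub_cancel]
  calc ENNReal.ofReal (a * (1 + √d) ^ (-(d / q)) * (2 ^ m) ^ (-σ))
      = ENNReal.ofReal a / ENNReal.ofReal ((1 + √d) ^ (d / q) * (2 ^ m) ^ σ) := by
        rw [← ENNReal.ofReal_div_of_pos (by positivity), Real.rpow_neg (by positivity),
          Real.rpow_neg (by positivity)]
        congr 1
        field_simp
    _ ≤ _ := by
        gcongr
        exact hf j hj' z hzc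

theorem gridSet_zero_subset (N k : ℕ) (h : N ≤ k) :
    (gridSet N k 0 : Set (E d)) ⊆ idx 0 ⁻¹' {0} := by
  rintro x ⟨j, hj, hx⟩
  rw [Set.mem_preimage, Set.mem_singleton_iff, idx_eq_ediv (Nat.zero_le k)]
  funext i
  rw [hx, Nat.sub_zero]
  have h1 := Finset.mem_range.1 (Fintype.mem_piFinset.1 hj i)
  simp only [zero_add, corner, Pi.zero_apply]
  refine Int.ediv_eq_zero_of_lt (by positivity) ?_
  calc (2 : ℤ) ^ N * j i < 2 ^ N * 2 ^ (k - N) := by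
        have : (j i : ℤ) < 2 ^ (k - N) := by exact_mod_cast h1
        gcongr
    _ = 2 ^ k := by rw [← pow_add, Nat.add_sub_cancel' h]

theorem subset_gridSet_zero (e : ℕ) : (idx 0 ⁻¹' {0} : Set (E d)) ⊆ gridSet 0 e 0 := by
  intro x hx
  have h1 : ∀ i, idx e x i / 2 ^ e = 0 := fun i => by
    have := idx_eq_ediv (Nat.zero_le e) x
    rw [Set.mem_preimage, Set.mem_singleton_iff, this] at hx
    simpa using congrFun hx i
  have h2 : ∀ i, 0 ≤ idx e x i ∧ idx e x i < 2 ^ e := fun i => by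
    have h3 := Int.mul_ediv_add_emod (idx e x i) (2 ^ e)
    have h4 := Int.emod_nonneg (idx e x i) (b := 2 ^ e) (by positivity)
    have h5 := Int.emod_lt_of_pos (idx e x i) (b := 2 ^ e) (by positivity)
    rw [h1, mul_zero, zero_add] at h3
    exact ⟨h3 ▸ h4, h3 ▸ h5⟩
  refine ⟨fun i => (idx e x i).toNat, Fintype.mem_piFinset.2 fun i => ?_, ?_⟩
  · rw [Finset.mem_range, Nat.sub_zero, Int.toNat_lt (h2 i).1]
    exact_mod_cast (h2 i).2
  · funext i
    simp [corner, (h2 i).1]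

/-- Hölder with exponent `p / q ≥ 1` on the unit cube, a probability space. The measurable minorant
`g` avoids any measurability of the maximal functions. -/
theorem rpow_lintegral_le_mixedNorm {p q : ℝ} (hq : 0 < q) (hqp : q ≤ p) (N : ℕ)
    (G : ℕ → E d → ℝ≥0∞) {g : E d → ℝ≥0∞} (hg : Measurable g)
    (hgG : ∀ x ∈ (idx 0 ⁻¹' {0} : Set (E d)),
      g x ≤ ∑ k ∈ Finset.Icc N (2 ^ (N * d)), G k x ^ q) :
    (∫⁻ x in (idx 0 ⁻¹' {0} : Set (E d)), g x) ^ q⁻¹ ≤ mixedNorm p q N G := by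
  have hp : 0 < p := hq.trans_le hqp
  have hs : 1 ≤ p / q := (one_le_div hq).2 hqp
  set U : Set (E d) := idx 0 ⁻¹' {0}
  have hU : MeasurableSet U := measurable_idx 0 (measurableSet_singleton _)
  have hvol : volume U = 1 := by
    rw [volume_idx_preimage]
    simp
  have : IsProbabilityMeasure (volume.restrict U) := ⟨by simp [hvol]⟩
  have h1 := eLpNorm_le_eLpNorm_of_exponent_le (μ := volume.restrict U) (f := g)
    (p := 1) (q := ENNReal.ofReal (p / q)) (by simpa using hs) hg.aestronglyMeasurable
  rw [eLpNorm_one_eq_lintegral_enorm, eLpNorm_eq_lintegral_rpow_enorm_toReal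
    (by simpa using by positivity) ENNReal.ofReal_ne_top, ENNReal.toReal_ofReal (by positivity)]
    at h1
  simp only [enorm_eq_self] at h1
  rw [mixedNorm_eq hp]
  calc (∫⁻ x in U, g x) ^ q⁻¹ ≤ ((∫⁻ x in U, g x ^ (p / q)) ^ (1 / (p / q))) ^ q⁻¹ := by gcongr
    _ = (∫⁻ x in U, g x ^ (p / q)) ^ (1 / p) := by
        rw [← ENNReal.rpow_mul]
        congr 1
        field_simp
    _ ≤ (∫⁻ x in U, (∑ k ∈ Finset.Icc N (2 ^ (N * d)), G k x ^ q) ^ (p / q)) ^ (1 / p) := by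
        gcongr ?_ ^ _
        refine setLIntegral_mono' hU fun x hx => ?_
        gcongr
        exact hgG x hx
    _ ≤ _ := by
        gcongr
        exact Measure.restrict_le_self

theorem two_pow_le_card (hd : 0 < d) (N : ℕ) :
    2 ^ (N * d) ≤ 2 * (Finset.Icc N (2 ^ (N * d))).card := by
  have h1 : 2 * N ≤ 2 ^ N + 2 := by
    induction N with
    | zero => simp
    | succ n ih =>
      rcases n with _ | n
      · simp
      · have := Nat.one_le_two_pow (n := n)
        rw [pow_succ] at ih ⊢
        rw [pow_succ]
        omega
  have h2 : 2 ^ N ≤ 2 ^ (N * d) := Nat.pow_le_pow_right (by norm_num) (Nat.le_mul_of_pos_right _ hd)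
  rw [Nat.card_Icc]
  omega

theorem ofReal_le_mixedNorm_of_pointwise (hd : 0 < d) {η : 𝓢(E d, ℂ)} {M : ℝ} {a : ℝ}
    (ha : 0 < a) {N : ℕ}
    (hf : ∀ k, ∀ j ∈ box d N k, ∀ x ∈ cube M N k j, ENNReal.ofReal a ≤ ‖f η M N k x‖ₑ)
    {p q σ : ℝ} (hq : 0 < q) (hqp : q ≤ p) (hσ : 0 ≤ σ) (hσq : σ ≤ d / q) :
    ENNReal.ofReal (a * (1 + √d) ^ (-(d / q)) * 4⁻¹ ^ q⁻¹ * (2 : ℝ) ^ (N * (d / q - σ))) ≤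
      mixedNorm p q N (fun k => peetreMax σ ((2 : ℝ) ^ k) (f η M N k)) := by
  set b : ℝ := a * (1 + √d) ^ (-(d / q))
  have hb : 0 < b := by positivity
  refine le_trans ?_ (rpow_lintegral_le_mixedNorm hq hqp N _
    (g := fun _ => (Finset.Icc N (2 ^ (N * d))).card * ENNReal.ofReal (b * (2 ^ N) ^ (-σ)) ^ q)
    measurable_const fun x hx => ?_)
  · rw [ENNReal.le_rpow_inv_iff hq, lintegral_const, Measure.restrict_apply_univ,
      volume_idx_preimage, zero_mul, pow_zero, inv_one, mul_one,
      ENNReal.ofReal_rpow_of_pos (by positivity), ENNReal.ofReal_rpow_of_pos (by positivity),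
      ← ENNReal.ofReal_natCast, ← ENNReal.ofReal_mul (by positivity)]
    refine ENNReal.ofReal_le_ofReal ?_
    have h1 : ((2 : ℝ) ^ (N * (d / q - σ))) = ((2 : ℝ) ^ (N * d)) ^ q⁻¹ * (2 ^ N) ^ (-σ) := by
      rw [← Real.rpow_natCast, ← Real.rpow_natCast, ← Real.rpow_mul (by norm_num),
        ← Real.rpow_mul (by norm_num), ← Real.rpow_add (by norm_num)]
      congr 1
      push_cast
      field_simp
      ring
    have h2 : (2 : ℝ) ^ (N * d) ≤ 2 * (Finset.Icc N (2 ^ (N * d))).card := by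
      exact_mod_cast two_pow_le_card hd N
    clear_value b
    rw [h1, Real.mul_rpow (by positivity) (by positivity), Real.mul_rpow hb.le (by positivity),
      Real.mul_rpow (by positivity) (by positivity), Real.mul_rpow hb.le (by positivity),
      Real.rpow_inv_rpow (by norm_num) hq.ne', Real.rpow_inv_rpow (by positivity) hq.ne']
    have h3 : (0 : ℝ) ≤ b ^ q * ((2 ^ N) ^ (-σ)) ^ q := by positivity
    -- A factor `1/2` would do; `1/4` matches the constant of `ofReal_le_mixedNorm_of_average`.
    have h4 : (4⁻¹ : ℝ) * 2 ^ (N * d) ≤ (Finset.Icc N (2 ^ (N * d))).card := by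
      have : (0 : ℝ) ≤ (Finset.Icc N (2 ^ (N * d))).card := by positivity
      linarith
    calc _ = (4⁻¹ * 2 ^ (N * d)) * (b ^ q * ((2 ^ N) ^ (-σ)) ^ q) := by ring
      _ ≤ _ := by gcongr
  · rw [← nsmul_eq_mul]
    refine Finset.card_nsmul_le_sum _ _ _ fun k hk => ?_
    gcongr
    refine le_peetreMax ha (hf k) le_rfl (Finset.mem_Icc.1 hk).1 hσ hσq ?_
    rw [Nat.sub_self]
    exact subset_gridSet_zero _ hx

theorem sum_range_inv_two_pow_le (hd : 0 < d) (N m₀ : ℕ) :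
    ∑ m ∈ Finset.Icc m₀ N, ((2 : ℝ≥0∞) ^ (m * d))⁻¹ ≤ 2 * ((2 : ℝ≥0∞) ^ (m₀ * d))⁻¹ := by
  refine le_trans (le_of_eq ?_) (mul_le_mul_left (sum_inv_two_pow_le hd m₀ N) _)
  rw [Finset.sum_mul]
  refine Finset.sum_congr rfl fun m hm => ?_
  rw [← ENNReal.mul_inv (by simp) (by simp), ← pow_add, ← add_mul,
    Nat.sub_add_cancel (Finset.mem_Icc.1 hm).1]

/-- If `m₀` is the first scale whose set contains `x`, the sum is a geometric tail of size at most
`2 · 2^{-m₀d}`, while `le_peetreMax` at `m₀` with `σ ≤ d/q` gives `2^{-m₀d}` after taking the `q`-th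
power. -/
theorem sum_chi_le_peetreMax (hd : 0 < d) {η : 𝓢(E d, ℂ)} {M : ℝ} {a : ℝ} (ha : 0 < a) {N k : ℕ}
    (hf : ∀ j ∈ box d N k, ∀ x ∈ cube M N k j, ENNReal.ofReal a ≤ ‖f η M N k x‖ₑ)
    (hNk : N ≤ k) {q σ : ℝ} (hq : 0 < q) (hσ : 0 ≤ σ) (hσq : σ ≤ d / q) (x : E d) :
    ENNReal.ofReal (a * (1 + √d) ^ (-(d / q))) ^ q / 2 * ∑ m ∈ Finset.range (N + 1),
        ((2 : ℝ≥0∞) ^ (m * d))⁻¹ * chi (N - m) (k - m) 0 x ≤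
      peetreMax σ ((2 : ℝ) ^ k) (f η M N k) x ^ q := by
  classical
  set b : ℝ := a * (1 + √d) ^ (-(d / q))
  have hb : 0 < b := by positivity
  by_cases hex : ∃ m, m ≤ N ∧ x ∈ gridSet (N - m) (k - m) 0
  · obtain ⟨hm₁, hm₂⟩ := Nat.find_spec hex
    set m₀ := Nat.find hex
    have h1 : ∑ m ∈ Finset.range (N + 1), ((2 : ℝ≥0∞) ^ (m * d))⁻¹ * chi (N - m) (k - m) 0 x
        ≤ 2 * ((2 : ℝ≥0∞) ^ (m₀ * d))⁻¹ := by
      refine le_trans ?_ (sum_range_inv_two_pow_le hd N m₀)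
      rw [← Finset.sum_subset (s₁ := Finset.Icc m₀ N)]
      · refine Finset.sum_le_sum fun m _ => ?_
        rcases chi_eq_zero_or_one (N - m) (k - m) 0 x with h | h <;> simp [h]
      · intro m hm
        rw [Finset.mem_range]
        have := (Finset.mem_Icc.1 hm).2
        omega
      · intro m hm hm'
        rw [Finset.mem_range] at hm
        rw [Finset.mem_Icc] at hm'
        have hlt : m < m₀ := by omega
        have hnot := Nat.find_min hex hlt
        have : x ∉ gridSet (N - m) (k - m) 0 := fun hx => hnot ⟨by omega, hx⟩
        simp [chi, this]
    have h2 := le_peetreMax ha hf hm₁ hNk hσ hσq hm₂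
    have h3 : b * (2 ^ m₀) ^ (-(d / q)) ≤ b * (2 ^ m₀) ^ (-σ) := by
      gcongr
      exact one_le_pow₀ (by norm_num)
    calc _ ≤ ENNReal.ofReal b ^ q / 2 * (2 * ((2 : ℝ≥0∞) ^ (m₀ * d))⁻¹) := by gcongr
      _ = ENNReal.ofReal b ^ q * ((2 : ℝ≥0∞) ^ (m₀ * d))⁻¹ := by
          rw [← mul_assoc, ENNReal.div_mul_cancel (by simp) (by simp)]
      _ = ENNReal.ofReal (b * (2 ^ m₀) ^ (-(d / q))) ^ q := by
          rw [ENNReal.ofReal_mul hb.le, ENNReal.mul_rpow_of_nonneg _ _ hq.le]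
          congr 1
          rw [ENNReal.ofReal_rpow_of_pos (by positivity), ← Real.rpow_mul (by positivity),
            neg_mul, div_mul_cancel₀ _ hq.ne', Real.rpow_neg (by positivity), Real.rpow_natCast,
            ENNReal.ofReal_inv_of_pos (by positivity), ← pow_mul,
            ENNReal.ofReal_pow (by norm_num)]
          norm_num
      _ ≤ _ := by
          gcongr
          exact (ENNReal.ofReal_le_ofReal h3).trans h2
  · push Not at hex
    rw [Finset.sum_eq_zero, mul_zero]
    · exact zero_le
    · intro m hm
      have := hex m (by rw [Finset.mem_range] at hm; omega)
      simp [chi, this]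

theorem ofReal_le_mixedNorm_of_average (hd : 0 < d) {η : 𝓢(E d, ℂ)} {M : ℝ} {a : ℝ}
    (ha : 0 < a) {N : ℕ}
    (hf : ∀ k, ∀ j ∈ box d N k, ∀ x ∈ cube M N k j, ENNReal.ofReal a ≤ ‖f η M N k x‖ₑ)
    {p q σ : ℝ} (hq : 0 < q) (hqp : q ≤ p) (hσ : 0 ≤ σ) (hσq : σ ≤ d / q) :
    ENNReal.ofReal (a * (1 + √d) ^ (-(d / q)) * 4⁻¹ ^ q⁻¹ * (N : ℝ) ^ (1 / q)) ≤
      mixedNorm p q N (fun k => peetreMax σ ((2 : ℝ) ^ k) (f η M N k)) := by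
  set b : ℝ := a * (1 + √d) ^ (-(d / q))
  have hb : 0 < b := by positivity
  have hmeas : ∀ N k : ℕ, Measurable (chi N k 0 : E d → ℝ≥0∞) :=
    fun N k => measurable_iterSum N 0 0 k
  have hmeas' : ∀ k : ℕ, Measurable fun x : E d => ∑ m ∈ Finset.range (N + 1),
      ((2 : ℝ≥0∞) ^ (m * d))⁻¹ * chi (N - m) (k - m) 0 x :=
    fun k => Finset.measurable_sum _ fun m _ => (hmeas _ _).const_mul _
  refine le_trans ?_ (rpow_lintegral_le_mixedNorm hq hqp N _
    (g := fun x => ∑ k ∈ Finset.Icc N (2 ^ (N * d)), ENNReal.ofReal b ^ q / 2 *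
      ∑ m ∈ Finset.range (N + 1), ((2 : ℝ≥0∞) ^ (m * d))⁻¹ * chi (N - m) (k - m) 0 x)
    (Finset.measurable_sum _ fun k _ => (hmeas' k).const_mul _) fun x _ => ?_)
  -- The weight `2^{-md}` exactly balances the measure `2^{-(N-m)d}`, so all scales contribute
  -- equally.
  · have hint : ∀ k ∈ Finset.Icc N (2 ^ (N * d)), ∀ m ∈ Finset.range (N + 1),
        ((2 : ℝ≥0∞) ^ (m * d))⁻¹ *
          ∫⁻ x in (idx 0 ⁻¹' {0} : Set (E d)), chi (N - m) (k - m) 0 x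
        = ((2 : ℝ≥0∞) ^ (N * d))⁻¹ := by
      intro k hk m hm
      rw [Finset.mem_Icc] at hk
      rw [Finset.mem_range] at hm
      have hle : N - m ≤ k - m := by omega
      rw [chi, lintegral_indicator_one (measurableSet_gridSet _ _ _),
        Measure.restrict_eq_self _ (gridSet_zero_subset _ _ hle), volume_gridSet hle,
        ← ENNReal.mul_inv (by simp) (by simp), ← pow_add, ← add_mul,
        Nat.add_sub_cancel' (by omega)]
    rw [lintegral_finsetSum _ fun k _ => (hmeas' k).const_mul _]
    have hk : ∀ k ∈ Finset.Icc N (2 ^ (N * d)), ∫⁻ x in (idx 0 ⁻¹' {0} : Set (E d)),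
        ENNReal.ofReal b ^ q / 2 * ∑ m ∈ Finset.range (N + 1),
          ((2 : ℝ≥0∞) ^ (m * d))⁻¹ * chi (N - m) (k - m) 0 x
        = ENNReal.ofReal b ^ q / 2 * ((N + 1 : ℕ) * ((2 : ℝ≥0∞) ^ (N * d))⁻¹) := by
      intro k hk
      rw [lintegral_const_mul _ (hmeas' k),
        lintegral_finsetSum _ fun m _ => (hmeas _ _).const_mul _]
      congr 1
      rw [← nsmul_eq_mul]
      convert Finset.sum_const (s := Finset.range (N + 1)) (((2 : ℝ≥0∞) ^ (N * d))⁻¹) using 1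
      · refine Finset.sum_congr rfl fun m hm => ?_
        rw [lintegral_const_mul _ (hmeas _ _), hint k hk m hm]
      · rw [Finset.card_range]
    rw [Finset.sum_congr rfl hk, Finset.sum_const, nsmul_eq_mul, ENNReal.le_rpow_inv_iff hq]
    have hcard : (1 : ℝ≥0∞) ≤ 2 * ((Finset.Icc N (2 ^ (N * d))).card *
        ((2 : ℝ≥0∞) ^ (N * d))⁻¹) := by
      rw [← mul_assoc, ← div_eq_mul_inv, ENNReal.le_div_iff_mul_le (by simp) (by simp), one_mul]
      exact_mod_cast two_pow_le_card hd N
    clear_value b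
    calc ENNReal.ofReal (b * 4⁻¹ ^ q⁻¹ * (N : ℝ) ^ (1 / q)) ^ q
        = ENNReal.ofReal b ^ q * (4⁻¹ * N) := by
          rw [mul_assoc, ENNReal.ofReal_mul hb.le, ENNReal.mul_rpow_of_nonneg _ _ hq.le, one_div,
            ← Real.mul_rpow (by norm_num) (by positivity),
            ← ENNReal.ofReal_rpow_of_nonneg (by positivity) (by positivity), ← ENNReal.rpow_mul,
            inv_mul_cancel₀ hq.ne', ENNReal.rpow_one, ENNReal.ofReal_mul (by norm_num),
            ENNReal.ofReal_natCast, ENNReal.ofReal_inv_of_pos (by norm_num)]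
          norm_num
      _ ≤ ENNReal.ofReal b ^ q * (4⁻¹ * (N + 1 : ℕ)) * (2 *
            ((Finset.Icc N (2 ^ (N * d))).card * ((2 : ℝ≥0∞) ^ (N * d))⁻¹)) := by
          rw [← mul_one (ENNReal.ofReal b ^ q * (4⁻¹ * (N : ℝ≥0∞)))]
          gcongr
          omega
      _ = _ := by
          have h4 : (4⁻¹ : ℝ≥0∞) * 2 = 2⁻¹ := by
            rw [show (4 : ℝ≥0∞) = 2 * 2 by norm_num, ENNReal.mul_inv (by simp) (by simp),
              mul_assoc, ENNReal.inv_mul_cancel (by simp) (by simp), mul_one]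
          rw [div_eq_mul_inv, ← h4]
          ring
  · refine Finset.sum_le_sum fun k hk => ?_
    exact sum_chi_le_peetreMax hd ha (hf k) (Finset.mem_Icc.1 hk).1 hq hσ hσq x

/-- The lower bound for the Peetre square function. -/
theorem exists_le_mixedNorm_peetreMax (hd : 0 < d) {p q : ℝ} (hq : 0 < q) (hqp : q ≤ p) {M : ℝ}
    (hM : 0 < M) :
    ∃ c : ℝ, 0 < c ∧ ∀ η : 𝓢(E d, ℂ), IsAdmissible M η →
      ∃ N₀ : ℕ, ∀ N : ℕ, N₀ ≤ N → ∀ σ : ℝ, 0 ≤ σ → σ ≤ d / q →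
        ENNReal.ofReal (c * max ((2 : ℝ) ^ (N * (d / q - σ))) ((N : ℝ) ^ (1 / q))) ≤
          mixedNorm p q N (fun k => peetreMax σ ((2 : ℝ) ^ k) (f η M N k)) := by
  have ha : (0 : ℝ) < ((2 : ℝ) ^ (-M)) ^ d / 2 := by positivity
  refine ⟨((2 : ℝ) ^ (-M)) ^ d / 2 * (1 + √d) ^ (-(d / q)) * 4⁻¹ ^ q⁻¹, by positivity,
    fun η hη => ?_⟩
  obtain ⟨N₀, hN₀⟩ := exists_le_enorm_f hM hη
  refine ⟨N₀, fun N hN σ hσ hσq => ?_⟩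
  rcases max_choice ((2 : ℝ) ^ (N * (d / q - σ))) ((N : ℝ) ^ (1 / q)) with h | h <;> rw [h]
  · exact ofReal_le_mixedNorm_of_pointwise hd ha (hN₀ N hN) hq hqp hσ hσq
  · exact ofReal_le_mixedNorm_of_average hd ha (hN₀ N hN) hq hqp hσ hσq

/-! ### Regularity and spectrum of `f_k`. -/

theorem integrable_h (M : ℝ) (N k : ℕ) : Integrable (h M N k : E d → ℂ) := by
  unfold h
  refine integrable_finsetSum _ fun j _ => ?_
  rw [integrable_indicator_iff (measurableSet_cube M N k j)]
  exact integrableOn_const (by rw [volume_cube]; exact ENNReal.ofReal_ne_top)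

theorem bddAbove_norm_dilate (η : 𝓢(E d, ℂ)) (k : ℕ) :
    BddAbove (Set.range fun x => ‖dilate η k x‖) := by
  obtain ⟨B, -, hB⟩ := exists_decay η 0
  refine ⟨2 ^ (k * d) * B, ?_⟩
  rintro _ ⟨x, rfl⟩
  simp only [dilate, norm_mul, norm_pow, RCLike.norm_ofNat]
  gcongr
  simpa using hB ((2 : ℝ) ^ k • x)

theorem fourier_dilate (η : 𝓢(E d, ℂ)) (k : ℕ) (ξ : E d) :
    𝓕 (dilate η k) ξ = 𝓕 (fun x => η x) (((2 : ℝ) ^ k)⁻¹ • ξ) := by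
  have h2 : (2 : ℝ) ^ k ≠ 0 := by positivity
  rw [Real.fourier_eq', Real.fourier_eq']
  have h1 := Measure.integral_comp_smul (volume : Measure (E d))
    (fun v => Complex.exp (((-2 * Real.pi * inner ℝ v (((2 : ℝ) ^ k)⁻¹ • ξ) : ℝ) : ℂ) * Complex.I) •
      η v) ((2 : ℝ) ^ k)
  rw [finrank_euclideanSpace_fin, ← pow_mul, abs_of_pos (by positivity),
    eq_inv_smul_iff₀ (by positivity)] at h1
  rw [← h1, ← integral_smul]
  congr 1
  funext x
  rw [inner_smul_left, inner_smul_right, conj_trivial, mul_inv_cancel_left₀ h2, dilate,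
    Complex.real_smul]
  push_cast
  simp only [smul_eq_mul]
  ring

/-- The spectrum of `f_k` lies in the annulus `2^{k-1} ≤ |ξ| ≤ 2^k`. -/
theorem spectrumInAnnulus_f {M : ℝ} {η : 𝓢(E d, ℂ)} (hη : IsAdmissible M η) (N k : ℕ) :
    SpectrumInAnnulus ((2 : ℝ) ^ k) (f η M N k) := by
  refine ⟨?_, ?_, fun ξ hξ => ?_⟩
  · exact (bddAbove_norm_dilate η k).continuous_convolution_right_of_integrable _
      (integrable_h M N k) (continuous_dilate η k)
  · exact (integrable_h M N k).integrable_convolution _ (integrable_dilate η k)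
  · have h1 := Real.fourier_mul_convolution_eq (integrable_h M N k) (integrable_dilate η k) ξ
    unfold f at hξ
    rw [h1, fourier_dilate] at hξ
    have h2 := hη.1.2.2 _ (right_ne_zero_of_mul hξ)
    have h3 : (0 : ℝ) < 2 ^ k := by positivity
    rw [norm_smul, norm_inv, Real.norm_of_nonneg h3.le] at h2
    have h4 : 2 * Real.pi * ((2 ^ k)⁻¹ * ‖ξ‖) = 2 * Real.pi * ‖ξ‖ / 2 ^ k := by ring
    rw [h4, le_div_iff₀ h3, div_le_iff₀ h3] at h2
    constructor <;> linarith [h2.1, h2.2]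

/-! ### Existence of admissible functions. -/

/-- A radial bump function supported in the annulus `1/2 ≤ 2π|ξ| ≤ 1`. -/
theorem exists_radial_bump (hd : 0 < d) :
    ∃ φ : E d → ℝ, ContDiff ℝ (⊤ : ℕ∞) φ ∧ HasCompactSupport φ ∧ (∀ ξ, 0 ≤ φ ξ) ∧
      (∀ ξ, φ (-ξ) = φ ξ) ∧ (∃ ξ, φ ξ ≠ 0) ∧
      ∀ ξ, φ ξ ≠ 0 → 1 / 2 ≤ 2 * Real.pi * ‖ξ‖ ∧ 2 * Real.pi * ‖ξ‖ ≤ 1 := by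
  -- Applied to the squared norm, which is smooth at the origin; the support interval `(3/8, 7/8)`
  -- lies in `[1/4, 1]`.
  let b : ContDiffBump (5 / 8 : ℝ) := ⟨1 / 8, 1 / 4, by norm_num, by norm_num⟩
  have hb : ∀ t, b t ≠ 0 → 3 / 8 < t ∧ t < 7 / 8 := by
    intro t ht
    have h1 : t ∈ Function.support b := ht
    rw [b.support_eq, Metric.mem_ball, Real.dist_eq, abs_lt] at h1
    have : b.rOut = 1 / 4 := rfl
    rw [this] at h1
    constructor <;> linarith [h1.1, h1.2]
  have hann : ∀ ξ : E d, b ((2 * Real.pi * ‖ξ‖) ^ 2) ≠ 0 →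
      1 / 2 ≤ 2 * Real.pi * ‖ξ‖ ∧ 2 * Real.pi * ‖ξ‖ ≤ 1 := by
    intro ξ hξ
    have h1 := hb _ hξ
    have h2 : 0 ≤ 2 * Real.pi * ‖ξ‖ := by positivity
    constructor <;> nlinarith [h1.1, h1.2]
  refine ⟨fun ξ => b ((2 * Real.pi * ‖ξ‖) ^ 2), ?_, ?_, fun ξ => b.nonneg, fun ξ => ?_, ?_, hann⟩
  · simp only [mul_pow]
    exact b.contDiff.comp (contDiff_const.mul (contDiff_norm_sq ℝ))
  · refine HasCompactSupport.of_support_subset_isCompact (isCompact_closedBall (0 : E d) 1)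
      fun ξ hξ => ?_
    have h1 := (hann ξ hξ).2
    rw [mem_closedBall_zero_iff]
    nlinarith [Real.pi_gt_three, norm_nonneg ξ]
  · simp only [norm_neg]
  · refine ⟨EuclideanSpace.single ⟨0, hd⟩ (√(5 / 8) / (2 * Real.pi)), ?_⟩
    beta_reduce
    rw [PiLp.norm_single, Real.norm_of_nonneg (by positivity),
      mul_div_cancel₀ _ (by positivity), Real.sq_sqrt (by norm_num)]
    rw [b.one_of_mem_closedBall (Metric.mem_closedBall_self b.rIn_pos.le)]
    exact one_ne_zero

/-- A Schwartz function with spectrum in the annulus that is real and takes the value `2` at `0`. -/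
theorem exists_schwartz_spectrum (hd : 0 < d) :
    ∃ η : 𝓢(E d, ℂ), SpectrumInAnnulus 1 (fun x => η x) ∧ (∀ x, (η x).im = 0) ∧ η 0 = 2 := by
  obtain ⟨φ, hφ, hφc, hφ0, hφe, ⟨ξ₀, hξ₀⟩, hφs⟩ := exists_radial_bump hd
  have hI : 0 < ∫ ξ, φ ξ := hφ.continuous.integral_pos_of_hasCompactSupport_nonneg_nonzero
    hφc hφ0 hξ₀
  set a : ℝ := 2 / ∫ ξ, φ ξ with ha
  have hc : HasCompactSupport fun ξ => ((a * φ ξ : ℝ) : ℂ) :=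
    hφc.comp_left (g := fun t : ℝ => ((a * t : ℝ) : ℂ)) (by simp)
  have hs : ContDiff ℝ (⊤ : ℕ∞) fun ξ => ((a * φ ξ : ℝ) : ℂ) :=
    Complex.ofRealCLM.contDiff.comp (contDiff_const.mul hφ)
  set Φ : 𝓢(E d, ℂ) := hc.toSchwartzMap hs
  have hΦ_apply : ∀ ξ, Φ ξ = ((a * φ ξ : ℝ) : ℂ) := fun ξ => rfl
  refine ⟨𝓕⁻ Φ, ⟨(𝓕⁻ Φ).continuous, (𝓕⁻ Φ).integrable, fun ξ hξ => ?_⟩, fun x => ?_, ?_⟩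
  · have h1 : 𝓕 (fun x : E d => (𝓕⁻ Φ : 𝓢(E d, ℂ)) x) ξ = Φ ξ := by
      rw [← SchwartzMap.fourier_coe, FourierTransform.fourier_fourierInv_eq]
    rw [h1, hΦ_apply] at hξ
    refine hφs ξ fun h => hξ ?_
    simp [h]
  -- The inverse transform of a real even function is real.
  · rw [← Complex.conj_eq_iff_im, SchwartzMap.fourierInv_coe, Real.fourierInv_eq', ← integral_conj,
      ← integral_neg_eq_self]
    congr 1
    funext ξ
    rw [smul_eq_mul, smul_eq_mul, map_mul, ← Complex.exp_conj, map_mul, Complex.conj_I,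
      hΦ_apply, hΦ_apply, Complex.conj_ofReal, Complex.conj_ofReal, hφe, inner_neg_left]
    push_cast
    ring_nf
  · rw [SchwartzMap.fourierInv_coe, Real.fourierInv_eq']
    simp only [inner_zero_right, mul_zero, Complex.ofReal_zero, zero_mul, Complex.exp_zero,
      one_smul, hΦ_apply]
    rw [integral_complex_ofReal, integral_const_mul, ha, div_mul_cancel₀ _ hI.ne']
    norm_num

/-- Since `η 0 = 2`, the real part exceeds 1 near the origin, and for large `M` the cube `|x_i| ≤
2^{-M}` lies in that neighbourhood; one `η` serves all such `M`. -/
theorem exists_isAdmissible (hd : 0 < d) :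
    ∃ M₀ : ℝ, ∀ M : ℝ, M₀ ≤ M → ∃ η : 𝓢(E d, ℂ), IsAdmissible M η := by
  obtain ⟨η, hη, him, h0⟩ := exists_schwartz_spectrum hd
  have hev : ∀ᶠ x in nhds (0 : E d), 1 < (η x).re := by
    have hcont : Continuous fun x => (η x).re := Complex.continuous_re.comp η.continuous
    refine hcont.continuousAt.eventually (lt_mem_nhds ?_)
    simp [h0]
  obtain ⟨ε, hε, hball⟩ := Metric.eventually_nhds_iff.1 hev
  have hlim : Filter.Tendsto (fun M : ℝ => √d * (2 : ℝ) ^ (-M)) Filter.atTop (nhds 0) := by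
    have h1 := (tendsto_rpow_atBot_of_base_gt_one (2 : ℝ) (by norm_num)).comp
      Filter.tendsto_neg_atTop_atBot
    simpa using h1.const_mul (√d)
  obtain ⟨M₀, hM₀⟩ := Filter.eventually_atTop.1 (hlim.eventually (gt_mem_nhds hε))
  refine ⟨M₀, fun M hM => ⟨η, hη, fun x hx => ⟨(hball ?_).le, him x⟩⟩⟩
  rw [dist_zero_right]
  exact (norm_le_sqrt_mul x _ (by positivity) hx).trans_lt (hM₀ M hM)

end DyadicPeetre

theorem mainTheorem6 (d : ℕ) (hd : 0 < d) :
    (∃ M₀ : ℝ, ∀ M : ℝ, M₀ ≤ M → ∃ η : 𝓢(DyadicPeetre.E d, ℂ), DyadicPeetre.IsAdmissible M η) ∧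
    (∀ M : ℝ, 0 < M → ∀ η : 𝓢(DyadicPeetre.E d, ℂ), DyadicPeetre.IsAdmissible M η →
      ∀ N k : ℕ, N ≤ k →
        DyadicPeetre.SpectrumInAnnulus ((2 : ℝ) ^ k) (DyadicPeetre.f η M N k)) ∧
    (∀ p q : ℝ, 0 < q → q ≤ p →
      (∀ η : 𝓢(DyadicPeetre.E d, ℂ), ∃ C : ℝ, ∀ M : ℝ, 0 < M → DyadicPeetre.IsAdmissible M η →
        ∀ N : ℕ,
          DyadicPeetre.mixedNorm p q N (fun k x => ‖DyadicPeetre.f η M N k x‖ₑ)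
            ≤ ENNReal.ofReal C) ∧
      (∀ M : ℝ, 0 < M → ∃ c : ℝ, 0 < c ∧
        ∀ η : 𝓢(DyadicPeetre.E d, ℂ), DyadicPeetre.IsAdmissible M η →
          ∃ N₀ : ℕ, ∀ N : ℕ, N₀ ≤ N → ∀ σ : ℝ, 0 ≤ σ → σ ≤ d / q →
            ENNReal.ofReal (c * max ((2 : ℝ) ^ (N * (d / q - σ))) ((N : ℝ) ^ (1 / q)))
              ≤ DyadicPeetre.mixedNorm p q N
                  (fun k => DyadicPeetre.peetreMax σ ((2 : ℝ) ^ k) (DyadicPeetre.f η M N k)))) := by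
  refine ⟨DyadicPeetre.exists_isAdmissible hd, fun M _ η hη N k _ =>
    DyadicPeetre.spectrumInAnnulus_f hη N k, fun p q hq hqp => ⟨fun η => ?_, fun M hM =>
      DyadicPeetre.exists_le_mixedNorm_peetreMax hd hq hqp hM⟩⟩
  obtain ⟨C, hC⟩ := DyadicPeetre.exists_mixedNorm_f_le hd hq hqp η
  exact ⟨C, fun M hM _ N => hC M hM N⟩
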